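/- All graphs are finite and simple, all posets are finite; the graph without vertices and the empty poset are allowed. \textbf{MAT-labeled graphs.} An edge-labeled graph $(G,\lambda)$ is a graph $G=(N_G,E_G)$ with a map $\lambda:E_G\to\mathbb{Z}_{>0}$. A \emph{conditioning vertex} of an edge $e$ with $\lambda(e)=k$ is a vertex that forms with the two endvertices of $e$ two edges, both of label $<k$. $(G,\lambda)$ is an \emph{MAT-labeled graph} if for every $k\ge 1$: (i) no edge of label $\le k$ forms a cycle with edges of label $k$; (ii) every edge of label $k$ has exactly $k-1$ conditioning vertices (i.e. forms exactly $k-1$ triangles with edges of label $<k$). For an edge $e$, the \emph{principal clique} $K_e$ consists of the endvertices and the conditioning vertices of $e$. A \emph{label-preserving homomorphism} $(G,\lambda)\to(G',\lambda')$ is a map $\sigma:N_G\to N_{G'}$ such that $\{u,v\}\in E_G$ implies $\{\sigma(u),\sigma(v)\}\in E_{G'}$ and $\lambda(u,v)=\lambda'(\sigma(u),\sigma(v))$. $\mathsf{MG}$ is the category of MAT-labeled graphs and label-preserving homomorphisms. \textbf{LR-vines.} A poset $\mathcal P$ is graded by $\operatorname{rk}:\mathcal P\to\mathbb Z_{>0}$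 if $x<y$ implies $\operatorname{rk}(x)<\operatorname{rk}(y)$, $\operatorname{rk}(y)=\operatorname{rk}(x)+1$ whenever $y$ covers $x$, and $\operatorname{rk}(x)=1$ for minimal $x$. Its rank is the largest value of $\operatorname{rk}$, its dimension is the number of minimal elements, $\mathcal P_i$ is the set of elements of rank $i$. A \emph{vine} is a graded poset such that every non-minimal element covers exactly two elements, any two distinct elements of equal rank are covered by at most one common element, and for each $1\le i\le \operatorname{rk}(\mathcal P)$ the graph $F_i$ with node set $\mathcal P_i$, whose edges are the sets of elements covered by the elements of $\mathcal P_{i+1}$, is a forest. An \emph{R-vine} is a vine whose rank equals its dimension, for which each $F_i$, $1\le i\le\operatorname{rk}(\mathcal P)$, is a tree, and such that any two distinct elements of equal rank $\ge 2$ that are covered by a common element cover a common element. An \emph{LR-vine} (locally regular vine) is a vine all of whose principal ideals $\{x\mid x\le a\}$ are R-vines. $\mathsf{LRV}$ is the category whose objects are LR-vines and whose morphisms are the order-preserving maps $\varphi$ with $\operatorname{rk}'(\varphi(x))=\operatorname{rk}(x)$ and such that, whenever the join $x\vee y$ exists, $\varphi(x)\vee\varphi(y)$ exists and equals $\varphi(x\vee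 y)$. For $v\in\mathcal P$ let $U_v$ be the set of minimal elements $\le v$; if $v$ is non-minimal and covers exactly $a$ and $b$, its conditioned set is $C_v=U_a\,\triangle\,U_b$. \textbf{Theorem.} (1) For an MAT-labeled graph $(G,\lambda)$, let $\Psi(G,\lambda)$ be the set of all singletons $\{i\}$, $i\in N_G$, and all principal cliques of $(G,\lambda)$, ordered by inclusion, with $\operatorname{rk}(v)=|v|$. This is an LR-vine. For a label-preserving homomorphism $\sigma$, the map $\Psi(\sigma):v\mapsto\{\sigma(a)\mid a\in v\}$ is a well-defined rank- and join-preserving homomorphism. This defines a functor $\Psi:\mathsf{MG}\to\mathsf{LRV}$. (2) For an LR-vine $\mathcal P$, let $\Omega(\mathcal P)$ be the graph on the minimal elements of $\mathcal P$ in which distinct $i,j$ are adjacent if and only if the join $i\vee j$ exists, with $\lambda(i,j)=\operatorname{rk}(i\vee j)-1$. This is an MAT-labeled graph, and its edges are exactly the conditioned sets $C_v$ of the non-minimal $v\in\mathcal P$. For a rank- and join-preserving homomorphism $\varphi$, the restriction $\Omega(\varphi)$ of $\varphi$ to the minimal elements is a well-defined label-preserving homomorphism. This defines a functor $\Omega:\mathsf{LRV}\to\mathsf{MG}$.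 (3) The composite functor $\Psi\Omega$ is naturally isomorphic to the identity functor $1_{\mathsf{LRV}}$, and $\Omega\Psi$ is naturally isomorphic to $1_{\mathsf{MG}}$. Consequently $\Psi$ and $\Omega$ are the two functors of an equivalence of the categories $\mathsf{MG}$ and $\mathsf{LRV}$. -/

import Mathlib

open CategoryTheory

universe u

/-! ### Edge-labeled graphs and MAT-labelings -/

/-- A finite simple graph together with a labeling of its edges by positive integers. -/
structure EdgeLabeledGraph where
  Vertex : Type u
  [finite : Finite Vertex]
  graph : SimpleGraph Vertex
  label : graph.edgeSet → ℕ+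

attribute [instance] EdgeLabeledGraph.finite

namespace EdgeLabeledGraph

/-- `h` is a conditioning vertex of the edge `e`: both edges joining `h` to the endvertices of `e`
exist, and their labels are smaller than the label of `e`. -/
def IsConditioningVertex (G : EdgeLabeledGraph.{u}) (e : G.graph.edgeSet) (h : G.Vertex) : Prop :=
  ∀ w ∈ (e : Sym2 G.Vertex), ∃ hw : s(w, h) ∈ G.graph.edgeSet, G.label ⟨s(w, h), hw⟩ < G.label e

/-- The labeling is an MAT-labeling.
`no_cycle`: an edge of label at most `k` does not form a cycle with edges of label `k`.
`triangles`: an edge of label `k` forms exactly `k - 1` triangles with edges of label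
smaller than `k`. -/
structure IsMAT (G : EdgeLabeledGraph.{u}) : Prop where
  no_cycle : ∀ (k : ℕ+) (e : G.graph.edgeSet), G.label e ≤ k →
    ¬ ∃ (x : G.Vertex) (c : G.graph.Walk x x), c.IsCycle ∧ (e : Sym2 G.Vertex) ∈ c.edges ∧
      ∀ f : G.graph.edgeSet, (f : Sym2 G.Vertex) ∈ c.edges → f ≠ e → G.label f = k
  triangles : ∀ e : G.graph.edgeSet, {h | G.IsConditioningVertex e h}.ncard + 1 = G.label e

/-- The principal clique generated by the edge `e`: the endvertices of `e` together with the
conditioning vertices of `e`. -/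
def principalClique (G : EdgeLabeledGraph.{u}) (e : G.graph.edgeSet) : Set G.Vertex :=
  {w | w ∈ (e : Sym2 G.Vertex)} ∪ {h | G.IsConditioningVertex e h}

/-- Label-preserving homomorphisms of edge-labeled graphs. -/
@[ext]
structure Hom (G G' : EdgeLabeledGraph.{u}) where
  toFun : G.Vertex → G'.Vertex
  map_edge : ∀ (x y : G.Vertex) (h : s(x, y) ∈ G.graph.edgeSet),
    ∃ h' : s(toFun x, toFun y) ∈ G'.graph.edgeSet,
      G'.label ⟨s(toFun x, toFun y), h'⟩ = G.label ⟨s(x, y), h⟩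

/-- The identity homomorphism. -/
def Hom.id (G : EdgeLabeledGraph.{u}) : Hom G G where
  toFun x := x
  map_edge _ _ h := ⟨h, rfl⟩

/-- Composition of label-preserving homomorphisms. -/
def Hom.comp {G G' G'' : EdgeLabeledGraph.{u}} (f : Hom G G') (g : Hom G' G'') : Hom G G'' where
  toFun x := g.toFun (f.toFun x)
  map_edge x y h := by
    obtain ⟨h', e'⟩ := f.map_edge x y h
    obtain ⟨h'', e''⟩ := g.map_edge _ _ h'
    exact ⟨h'', e''.trans e'⟩

end EdgeLabeledGraph

/-- MAT-labeled graphs. -/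
structure MG extends EdgeLabeledGraph.{u} where
  isMAT : toEdgeLabeledGraph.IsMAT

/-- The category of MAT-labeled graphs and label-preserving homomorphisms. -/
instance : Category MG.{u} where
  Hom G G' := EdgeLabeledGraph.Hom G.toEdgeLabeledGraph G'.toEdgeLabeledGraph
  id G := EdgeLabeledGraph.Hom.id G.toEdgeLabeledGraph
  comp f g := EdgeLabeledGraph.Hom.comp f g

/-! ### Graded posets and vines -/

section Vines

variable {P : Type u} [PartialOrder P]

/-- `rk` is a rank function, normalized to be `1` on minimal elements. -/
structure IsRankFunction (rk : P → ℕ) : Prop where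
  strictMono : ∀ x y, x < y → rk x < rk y
  covBy : ∀ x y, x ⋖ y → rk y = rk x + 1
  isMin : ∀ x, IsMin x → rk x = 1

/-- The set of elements covered by `v`. -/
def coveredSet (v : P) : Set P := {x | x ⋖ v}

/-- The `i`-th associated graph: its nodes are the elements of rank `i`, its edges are the sets of
elements covered by the elements of rank `i + 1`. -/
def associatedForest (rk : P → ℕ) (i : ℕ) : SimpleGraph {x : P // rk x = i} where
  Adj a b := a ≠ b ∧ ∃ v : P, rk v = i + 1 ∧ coveredSet v = {a.1, b.1}
  symm := ⟨fun a b ⟨hab, v, hv, hc⟩ => ⟨hab.symm, v, hv, by rw [hc, Set.pair_comm]⟩⟩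
  loopless := ⟨fun _ h => h.1 rfl⟩

/-- A poset with rank function `rk` is a vine. -/
structure IsVine (rk : P → ℕ) : Prop where
  isRank : IsRankFunction rk
  covers_two : ∀ v : P, ¬ IsMin v → (coveredSet v).ncard = 2
  covered_unique : ∀ a b : P, a ≠ b → rk a = rk b →
    ∀ v w : P, a ⋖ v → b ⋖ v → a ⋖ w → b ⋖ w → v = w
  forest : ∀ i, 1 ≤ i → i ≤ ⨆ x, rk x → (associatedForest rk i).IsAcyclic

/-- A vine is a regular vine (R-vine): its rank (the largest rank of an element) equals its
dimension (the number of minimal elements), its associated forests are trees, and the proximity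
condition holds. -/
structure IsRVine (rk : P → ℕ) : Prop where
  isVine : IsVine rk
  rank_eq_dim : ⨆ x, rk x = {x : P | IsMin x}.ncard
  tree : ∀ i, 1 ≤ i → i ≤ ⨆ x, rk x → (associatedForest rk i).IsTree
  proximity : ∀ a b : P, a ≠ b → rk a = rk b → 2 ≤ rk a →
    (∃ v, a ⋖ v ∧ b ⋖ v) → ∃ c, c ⋖ a ∧ c ⋖ b

/-- A vine is a locally regular vine (LR-vine): every principal ideal is an R-vine. -/
structure IsLRVine (rk : P → ℕ) : Prop where
  isVine : IsVine rk
  ideal : ∀ a : P, IsRVine (fun x : {x : P // x ≤ a} => rk x.1)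

/-- The complete union of a node: the minimal nodes below it. -/
def completeUnion (v : P) : Set P := {x | IsMin x ∧ x ≤ v}

/-- The conditioned set of a node `v` covering exactly the two nodes `a` and `b`: the symmetric
difference of the complete unions of `a` and `b`. -/
def conditionedSet (v : P) : Set P :=
  {i | ∃ a b, coveredSet v = {a, b} ∧ i ∈ symmDiff (completeUnion a) (completeUnion b)}

end Vines

/-- A finite poset with a function to the natural numbers (a rank function in all cases of
interest). -/
structure RankedPoset where
  Node : Type u
  [order : PartialOrder Node]
  [finite : Finite Node]
  rank : Node → ℕ

attribute [instance] RankedPoset.order RankedPoset.finite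

namespace RankedPoset

/-- Rank- and join-preserving poset homomorphisms. -/
@[ext]
structure Hom (P P' : RankedPoset.{u}) where
  toFun : P.Node → P'.Node
  monotone : Monotone toFun
  map_rank : ∀ x, P'.rank (toFun x) = P.rank x
  map_join : ∀ x y v, IsLUB {x, y} v → IsLUB {toFun x, toFun y} (toFun v)

/-- The identity homomorphism. -/
def Hom.id (P : RankedPoset.{u}) : Hom P P where
  toFun x := x
  monotone := monotone_id
  map_rank _ := rfl
  map_join _ _ _ h := h

/-- Composition of rank- and join-preserving homomorphisms. -/
def Hom.comp {P P' P'' : RankedPoset.{u}} (f : Hom P P') (g : Hom P' P'') : Hom P P'' where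
  toFun x := g.toFun (f.toFun x)
  monotone := g.monotone.comp f.monotone
  map_rank x := (g.map_rank _).trans (f.map_rank x)
  map_join x y v h := g.map_join _ _ _ (f.map_join x y v h)

end RankedPoset

/-- LR-vines. -/
structure LRV extends RankedPoset.{u} where
  isLRVine : IsLRVine rank

/-- The category of LR-vines and rank- and join-preserving homomorphisms. -/
instance : Category LRV.{u} where
  Hom P P' := RankedPoset.Hom P.toRankedPoset P'.toRankedPoset
  id P := RankedPoset.Hom.id P.toRankedPoset
  comp f g := RankedPoset.Hom.comp f g

/-! ### From MAT-labeled graphs to LR-vines -/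

/-- The poset of a graph `(G, λ)`: the singletons `{i}` and the principal cliques, ordered by
inclusion, with the cardinality as rank. -/
noncomputable def psiPoset (G : EdgeLabeledGraph.{u}) : RankedPoset.{u} where
  Node := {s : Set G.Vertex // (∃ i, s = {i}) ∨ ∃ e, s = G.principalClique e}
  rank s := s.1.ncard

/-- The functor `Ψ`. The hypotheses say that its values on objects and morphisms are well defined:
the poset of an MAT-labeled graph is an LR-vine, and `v ↦ σ(v)` is a rank- and join-preserving
homomorphism. -/
noncomputable def psiFunctor
    (hobj : ∀ G : MG.{u}, IsLRVine (psiPoset G.toEdgeLabeledGraph).rank)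
    (hmap : ∀ (G G' : MG.{u}) (σ : G ⟶ G'),
      ∃ φ : RankedPoset.Hom (psiPoset G.toEdgeLabeledGraph) (psiPoset G'.toEdgeLabeledGraph),
        ∀ v, (φ.toFun v).1 = EdgeLabeledGraph.Hom.toFun σ '' v.1) :
    MG.{u} ⥤ LRV.{u} where
  obj G := { toRankedPoset := psiPoset G.toEdgeLabeledGraph, isLRVine := hobj G }
  map {G G'} σ := (hmap G G' σ).choose
  map_id G := by
    refine RankedPoset.Hom.ext (funext fun v => Subtype.ext ?_)
    exact ((hmap G G (𝟙 G)).choose_spec v).trans (Set.image_id _)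
  map_comp {G G' G''} σ τ := by
    refine RankedPoset.Hom.ext (funext fun v => Subtype.ext ?_)
    refine ((hmap G G'' (σ ≫ τ)).choose_spec v).trans ?_
    refine Eq.trans ?_ ((hmap G' G'' τ).choose_spec _).symm
    rw [(hmap G G' σ).choose_spec v]
    exact Set.image_comp (EdgeLabeledGraph.Hom.toFun τ) (EdgeLabeledGraph.Hom.toFun σ) v.1

/-! ### From LR-vines to MAT-labeled graphs -/

/-- The graph on the minimal nodes in which two distinct nodes are adjacent when their join
exists. -/
def joinGraph (P : RankedPoset.{u}) : SimpleGraph {x : P.Node // IsMin x} where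
  Adj i j := i ≠ j ∧ ∃ v, IsLUB {i.1, j.1} v
  symm := ⟨fun i j ⟨hij, v, hv⟩ => ⟨hij.symm, v, by rwa [Set.pair_comm]⟩⟩
  loopless := ⟨fun _ h => h.1 rfl⟩

/-- An edge of the join graph has a join, and it has rank at least `2`. -/
theorem exists_join_of_edge (P : LRV.{u}) (e : (joinGraph P.toRankedPoset).edgeSet) :
    ∃ v : P.Node, IsLUB {x : P.Node | ∃ i ∈ (e : Sym2 {x : P.Node // IsMin x}), x = i.1} v ∧
      0 < P.rank v - 1 := by
  obtain ⟨e, he⟩ := e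
  induction e using Sym2.ind with
  | _ i j =>
    obtain ⟨hij, v, hv⟩ := he
    refine ⟨v, ?_, ?_⟩
    · have : {x : P.Node | ∃ k ∈ s(i, j), x = k.1} = {i.1, j.1} := by
        ext x
        simp
      rw [this]
      exact hv
    · have hi : i.1 ≤ v := hv.1 (by simp)
      have hj : j.1 ≤ v := hv.1 (by simp)
      have hlt : i.1 < v := by
        refine lt_of_le_of_ne hi fun h => hij (Subtype.ext ?_)
        exact le_antisymm (i.2 (h ▸ hj) |>.trans le_rfl) (h ▸ hj)
      have h1 := P.isLRVine.isVine.isRank.strictMono _ _ hlt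
      have h2 := P.isLRVine.isVine.isRank.isMin _ i.2
      omega

/-- The edge-labeled graph of an LR-vine: the vertices are the minimal nodes, `{i, j}` is an edge
when `i ≠ j` and the join of `i` and `j` exists, and the label of this edge is the rank of the join
minus `1`. -/
noncomputable def omegaGraph (P : LRV.{u}) : EdgeLabeledGraph.{u} where
  Vertex := {x : P.Node // IsMin x}
  graph := joinGraph P.toRankedPoset
  label e := ⟨P.rank (exists_join_of_edge P e).choose - 1, (exists_join_of_edge P e).choose_spec.2⟩

/-- The functor `Ω`. The hypotheses say that its values on objects and morphisms are well defined:
the graph of an LR-vine is an MAT-labeled graph, and the restriction of a rank- and join-preserving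
homomorphism to minimal nodes is a label-preserving homomorphism. -/
noncomputable def omegaFunctor
    (hobj : ∀ P : LRV.{u}, (omegaGraph P).IsMAT)
    (hmap : ∀ (P P' : LRV.{u}) (φ : P ⟶ P'),
      ∃ σ : EdgeLabeledGraph.Hom (omegaGraph P) (omegaGraph P'),
        ∀ i, (σ.toFun i).1 = RankedPoset.Hom.toFun φ i.1) :
    LRV.{u} ⥤ MG.{u} where
  obj P := { toEdgeLabeledGraph := omegaGraph P, isMAT := hobj P }
  map {P P'} φ := (hmap P P' φ).choose
  map_id P := by
    refine EdgeLabeledGraph.Hom.ext (funext fun i => Subtype.ext ?_)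
    exact (hmap P P (𝟙 P)).choose_spec i
  map_comp {P P' P''} φ ψ := by
    refine EdgeLabeledGraph.Hom.ext (funext fun i => Subtype.ext ?_)
    refine ((hmap P P'' (φ ≫ ψ)).choose_spec i).trans ?_
    refine Eq.trans ?_ ((hmap P' P'' ψ).choose_spec _).symm
    rw [(hmap P P' φ).choose_spec i]
    rfl

/-!
The equivalence between MAT-labeled graphs and LR-vines is proved by elementary means, from a
separation property on the side of graphs and from a Helly property on the side of vines.

*Graphs.* Write `G.lab x y` for the label of an edge, with `0` for non-adjacent vertices, `G.below
k` for the graph of the edges of label `< k`, and `G.cond a b` for the conditioning vertices of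
`ab`. An MAT-labeling has the properties collected in `IsWeakMAT`; notably the cliques of `G.below
k` have at most `k` vertices. By induction on `k` the graphs `G.below k` are chordal. The edges of
label `k` are added one by one: the common neighbours of the ends of such an edge `ab` separate
`a` from `b` (`IsWeakMAT.not_connIn_cond`), and adding an edge between vertices separated by their
common neighbours preserves chordality (`IsChordal.add_edge`). The outcome is
`IsWeakMAT.separates`: `G.cond a b` separates `a` from `b` among the edges other than `ab` of
label at most that of `ab`. Hence the singletons and principal cliques are precisely the nonempty
cliques all of whose labels are smaller than their cardinality (`IsWeakMAT.isNode_iff`). In this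
description the poset is easily handled: the principal clique of `ab` covers exactly the two
cliques obtained by removing `a` or `b`, it is the join of `{a}` and `{b}`, images under
label-preserving homomorphisms are again of this kind, and acyclicity of the associated graphs is
the separation property once more (`IsWeakMAT.isLRVine_psi`, `IsWeakMAT.exists_psi_map`).

*Vines.* In an LR-vine, each principal ideal cuts out a subtree of each associated forest.
Uniqueness of paths in forests, applied rank by rank upwards, shows that two elements of the same
rank below both `v` and `w` have a common upper bound below both (`IsLRVine.exists_between`), and
that principal ideals have a Helly property (`IsLRVine.helly`). The first fact gives joins of
bounded pairs of minimal elements, and the second identifies the conditioning vertices of an edge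
`ij` with the minimal elements below `i ∨ j` other than `i` and `j`, and bounds the cliques. So
the graph of an LR-vine satisfies `IsWeakMAT` (`LRV.isWeakMAT_omega`), and the condition on cycles
follows from the separation property by considering a shortest bad cycle (`IsWeakMAT.not_isPath`,
`IsWeakMAT.isMAT`).

*Equivalence.* The natural isomorphisms are `v ↦ {minimal elements below v}` and `i ↦ {i}`.
-/

/-! ### Connectivity inside a vertex set and chordality -/

section Chordality

open Relation

variable {V : Type*} {K K' : SimpleGraph V} {W W' : Set V} {u v w a b : V}

/-- `u` and `v` are joined by a walk of `K` all of whose vertices lie in `W`; the trivial walk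
at a vertex outside `W` is allowed. -/
def ConnIn (K : SimpleGraph V) (W : Set V) : V → V → Prop :=
  ReflTransGen fun x y => K.Adj x y ∧ x ∈ W ∧ y ∈ W

theorem ConnIn.refl (u : V) : ConnIn K W u u := ReflTransGen.refl

theorem ConnIn.of_adj (h : K.Adj u v) (hu : u ∈ W) (hv : v ∈ W) : ConnIn K W u v :=
  ReflTransGen.single ⟨h, hu, hv⟩

theorem ConnIn.trans (h : ConnIn K W u v) (h' : ConnIn K W v w) : ConnIn K W u w :=
  ReflTransGen.trans h h'

theorem ConnIn.symm (h : ConnIn K W u v) : ConnIn K W v u := by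
  induction h with
  | refl => exact .refl _
  | tail _ hs ih => exact .trans (.of_adj hs.1.symm hs.2.2 hs.2.1) ih

theorem ConnIn.mono (hK : K ≤ K') (hW : W ⊆ W') (h : ConnIn K W u v) : ConnIn K' W' u v :=
  ReflTransGen.mono (fun _ _ hs => ⟨hK hs.1, hW hs.2.1, hW hs.2.2⟩) _ _ h

theorem ConnIn.of_walk (p : K.Walk u v) (h : ∀ t ∈ p.support, t ∈ W) : ConnIn K W u v := by
  induction p with
  | nil => exact .refl _
  | cons hadj p ih =>
    have ht : ∀ t ∈ p.support, t ∈ W := fun t ht => h t (by simp [ht])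
    exact .trans (.of_adj hadj (h _ (by simp)) (ht _ p.start_mem_support)) (ih ht)

/-- A walk inside `W` stays inside the component of its end. -/
theorem ConnIn.in_component (h : ConnIn K W u v) : ConnIn K {w ∈ W | ConnIn K W w v} u v := by
  induction h using ReflTransGen.head_induction_on with
  | refl => exact .refl _
  | head hs h ih =>
    exact .trans (.of_adj hs.1 ⟨hs.2.1, .trans (.of_adj hs.1 hs.2.1 hs.2.2) h⟩ ⟨hs.2.2, h⟩) ih

/-- Chordality, phrased through connectivity: if two neighbours of `n` are joined by a walk inside a
set `W` that misses `n`, then they are joined by a walk inside `W` which visits only neighbours of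
`n`. For a chordless cycle through `n`, the set `W` of the other vertices violates this. -/
def IsChordal (K : SimpleGraph V) : Prop :=
  ∀ (n : V) (W : Set V) (u v : V), n ∉ W → K.Adj n u → K.Adj n v → u ∈ W → v ∈ W →
    ConnIn K W u v → ConnIn K (W ∩ {x | K.Adj n x}) u v

theorem isChordal_of_forall_not_adj (h : ∀ x y, ¬ K.Adj x y) : IsChordal K :=
  fun n _ u _ _ hu => (h n u hu).elim

/-- A chordal graph has no chordless 4-cycle. -/
theorem IsChordal.adj_of_adj (hK : IsChordal K) {m n : V} (huv : ¬ K.Adj u v) (hne : u ≠ v)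
    (hmn : m ≠ n) (hmu : K.Adj m u) (hmv : K.Adj m v) (hnu : K.Adj n u) (hnv : K.Adj n v) :
    K.Adj m n := by
  have h := hK u {m, v, n} m n (by simp [hmu.ne', hnu.ne', hne]) hmu.symm hnu.symm (by simp)
    (by simp) (.trans (.of_adj hmv (by simp) (by simp)) (.of_adj hnv.symm (by simp) (by simp)))
  rcases ReflTransGen.cases_head h with h | ⟨x, ⟨hadj, -, hx, hux⟩, -⟩
  · exact (hmn h).elim
  · simp only [Set.mem_insert_iff, Set.mem_singleton_iff, Set.mem_ofPred_eq] at hx hux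
    rcases hx with rfl | rfl | rfl
    · exact (K.loopless.irrefl _ hadj).elim
    · exact (huv hux).elim
    · exact hadj

/-- The defining property of a chordal graph, iterated over finitely many vertices. -/
theorem IsChordal.connIn_common (hK : IsChordal K) {S : Set V} (hS : S.Finite)
    (hW : ∀ s ∈ S, s ∉ W) (hu : u ∈ W) (hv : v ∈ W) (hSu : ∀ s ∈ S, K.Adj s u)
    (hSv : ∀ s ∈ S, K.Adj s v) (h : ConnIn K W u v) :
    ConnIn K (W ∩ {x | ∀ s ∈ S, K.Adj s x}) u v := by
  induction S, hS using Set.Finite.induction_on with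
  | empty => simpa using h
  | @insert s S hs hfin ih =>
    have ih' := ih (fun t ht => hW t (.inr ht)) (fun t ht => hSu t (.inr ht))
      (fun t ht => hSv t (.inr ht))
    have := hK s (W ∩ {x | ∀ t ∈ S, K.Adj t x}) u v (fun hm => hW s (.inl rfl) hm.1)
      (hSu s (.inl rfl)) (hSv s (.inl rfl))
      ⟨hu, fun t ht => hSu t (.inr ht)⟩ ⟨hv, fun t ht => hSv t (.inr ht)⟩ ih'
    refine this.mono le_rfl ?_
    rintro x ⟨⟨hx, hx'⟩, hxs⟩
    refine ⟨hx, ?_⟩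
    rintro t (rfl | ht)
    exacts [hxs, hx' t ht]

section AddEdge

variable (hK' : ∀ x y, K'.Adj x y ↔ K.Adj x y ∨ (x = a ∧ y = b) ∨ (x = b ∧ y = a))
include hK'

theorem ConnIn.of_add_edge (h : ConnIn K' W u v) :
    ConnIn K W u v ∨ (a ∈ W ∧ b ∈ W ∧ ((ConnIn K W u a ∧ ConnIn K W b v) ∨
      (ConnIn K W u b ∧ ConnIn K W a v))) := by
  induction h with
  | refl => exact .inl (.refl _)
  | @tail x y _ hs ih =>
    obtain ⟨hadj, hx, hy⟩ := hs
    rcases (hK' x y).1 hadj with hadj | ⟨rfl, rfl⟩ | ⟨rfl, rfl⟩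
    · have hxy : ConnIn K W x y := .of_adj hadj hx hy
      rcases ih with h | ⟨ha, hb, ⟨h1, h2⟩ | ⟨h1, h2⟩⟩
      · exact .inl (h.trans hxy)
      · exact .inr ⟨ha, hb, .inl ⟨h1, h2.trans hxy⟩⟩
      · exact .inr ⟨ha, hb, .inr ⟨h1, h2.trans hxy⟩⟩
    · rcases ih with h | ⟨-, -, ⟨h1, h2⟩ | ⟨h1, h2⟩⟩
      · exact .inr ⟨hx, hy, .inl ⟨h, .refl _⟩⟩
      · exact .inr ⟨hx, hy, .inl ⟨h1, .refl _⟩⟩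
      · exact .inl h1
    · rcases ih with h | ⟨-, -, ⟨h1, h2⟩ | ⟨h1, h2⟩⟩
      · exact .inr ⟨hy, hx, .inr ⟨h, .refl _⟩⟩
      · exact .inl h1
      · exact .inr ⟨hy, hx, .inr ⟨h1, .refl _⟩⟩

/-- The case of `IsChordal.add_edge` where the distinguished vertex is an end of the new edge. -/
theorem IsChordal.add_edge_aux (hK : IsChordal K) (hab : a ≠ b)
    (hsep : ¬ ConnIn K {s | K.Adj s a ∧ K.Adj s b}ᶜ a b)
    (ha : a ∉ W) (hau : K'.Adj a u) (hav : K'.Adj a v) (hu : u ∈ W) (hv : v ∈ W)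
    (h : ConnIn K' W u v) : ConnIn K' (W ∩ {x | K'.Adj a x}) u v := by
  have hle : K ≤ K' := fun x y hxy => (hK' x y).2 (.inl hxy)
  have hmono : W ∩ {x | K.Adj a x} ⊆ W ∩ {x | K'.Adj a x} := fun x hx => ⟨hx.1, hle hx.2⟩
  -- a neighbour `v` of `a` in the component of `b`: the walk `a, v, …, b` meets the separator
  have key : ∀ v ∈ W, b ∈ W → K.Adj a v → ConnIn K W b v →
      ConnIn K' (W ∩ {x | K'.Adj a x}) b v := by
    intro v hv hb hav hbv
    by_contra hcon
    refine hsep (ConnIn.mono (W := insert a {w ∈ W | ConnIn K W w v}) le_rfl ?_ ?_)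
    · rintro s (rfl | ⟨hsW, hsv⟩) ⟨hsa, hsb⟩
      · exact K.loopless.irrefl _ hsa
      · refine hcon (.trans (.of_adj (hle hsb.symm) ⟨hb, ?_⟩ ⟨hsW, hle hsa.symm⟩) ?_)
        · exact (hK' a b).2 (.inr (.inl ⟨rfl, rfl⟩))
        · exact (hK a W s v ha hsa.symm hav hsW hv hsv).mono hle hmono
    · refine .trans (.of_adj hav (.inl rfl) (.inr ⟨hv, .refl _⟩)) ?_
      exact hbv.in_component.symm.mono le_rfl (Set.subset_insert _ _)
  have hK'W : ConnIn K W u v := by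
    rcases h.of_add_edge hK' with h | ⟨h, -⟩
    exacts [h, (ha h).elim]
  have haux : ∀ x, K'.Adj a x → x = b ∨ K.Adj a x := by
    intro x hx
    rcases (hK' a x).1 hx with h | ⟨-, h⟩ | ⟨h, -⟩
    exacts [.inr h, .inl h, (hab h).elim]
  rcases haux u hau with rfl | hau' <;> rcases haux v hav with rfl | hav'
  · exact .refl _
  · exact key v hv hu hav' hK'W
  · exact (key u hu hv hau' hK'W.symm).symm
  · exact (hK a W u v ha hau' hav' hu hv hK'W).mono hle hmono

/-- Adding an edge `ab` to a chordal graph keeps it chordal when the common neighbours of `a` and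
`b` separate `a` from `b`. -/
theorem IsChordal.add_edge (hK : IsChordal K) (hab : a ≠ b)
    (hsep : ¬ ConnIn K {s | K.Adj s a ∧ K.Adj s b}ᶜ a b) : IsChordal K' := by
  intro n W u v hn hnu hnv hu hv h
  by_cases hna : n = a
  · subst hna
    exact hK.add_edge_aux hK' hab hsep hn hnu hnv hu hv h
  by_cases hnb : n = b
  · subst hnb
    refine hK.add_edge_aux (fun x y => (hK' x y).trans (or_congr Iff.rfl or_comm)) hab.symm
      (fun hc => hsep (hc.symm.mono le_rfl ?_)) hn hnu hnv hu hv h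
    exact Set.compl_subset_compl.2 fun s hs => ⟨hs.2, hs.1⟩
  have hle : K ≤ K' := fun x y hxy => (hK' x y).2 (.inl hxy)
  have hiff : ∀ x, K'.Adj n x ↔ K.Adj n x := by
    intro x
    simp [hK', hna, hnb]
  have hmono : W ∩ {x | K.Adj n x} ⊆ W ∩ {x | K'.Adj n x} := fun x hx => ⟨hx.1, hle hx.2⟩
  have hnu' := (hiff u).1 hnu
  have hnv' := (hiff v).1 hnv
  have done : ConnIn K W u v → ConnIn K' (W ∩ {x | K'.Adj n x}) u v := fun h =>
    (hK n W u v hn hnu' hnv' hu hv h).mono hle hmono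
  rcases h.of_add_edge hK' with h | ⟨ha, hb, h⟩
  · exact done h
  by_cases hS : K.Adj n a ∧ K.Adj n b
  · obtain ⟨hnA, hnB⟩ := hS
    have hadj : ConnIn K' (W ∩ {x | K'.Adj n x}) a b :=
      .of_adj ((hK' a b).2 (.inr (.inl ⟨rfl, rfl⟩))) ⟨ha, hle hnA⟩ ⟨hb, hle hnB⟩
    rcases h with ⟨h1, h2⟩ | ⟨h1, h2⟩
    · exact .trans ((hK n W u a hn hnu' hnA hu ha h1).mono hle hmono)
        (hadj.trans ((hK n W b v hn hnB hnv' hb hv h2).mono hle hmono))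
    · exact .trans ((hK n W u b hn hnu' hnB hu hb h1).mono hle hmono)
        (hadj.symm.trans ((hK n W a v hn hnA hnv' ha hv h2).mono hle hmono))
  · -- the detour through `n` joins `a` to `b`, so a common neighbour of `a` and `b` lies in `W`
    refine done ?_
    have hWn : W ⊆ insert n W := Set.subset_insert _ _
    have hun : ConnIn K (insert n W) u v :=
      .trans (.of_adj hnu'.symm (.inr hu) (.inl rfl)) (.of_adj hnv' (.inl rfl) (.inr hv))
    have hconn : ConnIn K (insert n W) a b := by
      rcases h with ⟨h1, h2⟩ | ⟨h1, h2⟩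
      · exact (h1.symm.mono le_rfl hWn).trans (hun.trans (h2.symm.mono le_rfl hWn))
      · exact (h2.mono le_rfl hWn).trans (hun.symm.trans (h1.mono le_rfl hWn))
    have : ∃ s ∈ W, K.Adj s a ∧ K.Adj s b := by
      by_contra hcon
      refine hsep (hconn.mono le_rfl ?_)
      rintro s (rfl | hs) hs'
      exacts [hS hs', hcon ⟨s, hs, hs'⟩]
    obtain ⟨s, hs, hsa, hsb⟩ := this
    have habW : ConnIn K W a b := .trans (.of_adj hsa.symm ha hs) (.of_adj hsb hs hb)
    rcases h with ⟨h1, h2⟩ | ⟨h1, h2⟩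
    · exact h1.trans (habW.trans h2)
    · exact h1.trans (habW.symm.trans h2)

end AddEdge

end Chordality

/-! ### The numerical label and the graphs of small labels -/

namespace EdgeLabeledGraph

open Relation

section Labels

variable (G : EdgeLabeledGraph.{u})

open Classical in
/-- The label of the edge `xy`, with the value `0` encoding that `x` and `y` are not adjacent. -/
noncomputable def lab (x y : G.Vertex) : ℕ :=
  if h : s(x, y) ∈ G.graph.edgeSet then (G.label ⟨s(x, y), h⟩ : ℕ) else 0

open Classical in
theorem lab_comm (x y : G.Vertex) : G.lab x y = G.lab y x := by
  have key : ∀ e e' : Sym2 G.Vertex, e = e' →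
      (if h : e ∈ G.graph.edgeSet then (G.label ⟨e, h⟩ : ℕ) else 0) =
        if h : e' ∈ G.graph.edgeSet then (G.label ⟨e', h⟩ : ℕ) else 0 := by
    rintro e _ rfl
    rfl
  exact key _ _ Sym2.eq_swap

theorem lab_eq {x y : G.Vertex} (h : s(x, y) ∈ G.graph.edgeSet) :
    (G.label ⟨s(x, y), h⟩ : ℕ) = G.lab x y := by
  rw [lab, dif_pos h]

theorem lab_pos_iff {x y : G.Vertex} : 0 < G.lab x y ↔ s(x, y) ∈ G.graph.edgeSet := by
  by_cases h : s(x, y) ∈ G.graph.edgeSet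
  · simp [← G.lab_eq h, h, -SimpleGraph.mem_edgeSet]
  · rw [lab, dif_neg h]
    simpa using h

@[simp] theorem lab_self (x : G.Vertex) : G.lab x x = 0 := by
  by_contra h
  exact G.graph.loopless.irrefl x (G.lab_pos_iff.1 (Nat.pos_of_ne_zero h))

theorem ne_of_lab_pos {x y : G.Vertex} (h : 0 < G.lab x y) : x ≠ y := by
  rintro rfl
  simp at h

theorem lab_congr {x y a b : G.Vertex} (h : s(x, y) = s(a, b)) : G.lab x y = G.lab a b := by
  rcases Sym2.eq_iff.1 h with ⟨rfl, rfl⟩ | ⟨rfl, rfl⟩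
  exacts [rfl, G.lab_comm _ _]

/-- The graph of the edges of label smaller than `k`. -/
def below (k : ℕ) : SimpleGraph G.Vertex where
  Adj x y := 0 < G.lab x y ∧ G.lab x y < k
  symm := ⟨fun x y h => by rwa [G.lab_comm y x]⟩
  loopless := ⟨fun x h => by simp at h⟩

theorem below_adj {k : ℕ} {x y : G.Vertex} :
    (G.below k).Adj x y ↔ 0 < G.lab x y ∧ G.lab x y < k := Iff.rfl

/-- The set of conditioning vertices of the edge `ab`, empty if `a` and `b` are not adjacent. -/
def cond (a b : G.Vertex) : Set G.Vertex :=
  {s | (G.below (G.lab a b)).Adj s a ∧ (G.below (G.lab a b)).Adj s b}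

theorem mem_cond {a b s : G.Vertex} : s ∈ G.cond a b ↔
    (0 < G.lab s a ∧ G.lab s a < G.lab a b) ∧ (0 < G.lab s b ∧ G.lab s b < G.lab a b) := Iff.rfl

theorem cond_comm (a b : G.Vertex) : G.cond a b = G.cond b a := by
  ext s
  rw [mem_cond, mem_cond, G.lab_comm a b, and_comm]

theorem left_notMem_cond (a b : G.Vertex) : a ∉ G.cond a b := fun h => by
  simp [mem_cond] at h

theorem right_notMem_cond (a b : G.Vertex) : b ∉ G.cond a b := fun h => by
  simp [mem_cond] at h

theorem isConditioningVertex_iff {a b h : G.Vertex} (he : s(a, b) ∈ G.graph.edgeSet) :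
    G.IsConditioningVertex ⟨s(a, b), he⟩ h ↔ h ∈ G.cond a b := by
  have key : ∀ w, (∃ hw : s(w, h) ∈ G.graph.edgeSet,
      G.label ⟨s(w, h), hw⟩ < G.label ⟨s(a, b), he⟩) ↔
      0 < G.lab h w ∧ G.lab h w < G.lab a b := by
    intro w
    rw [G.lab_comm h w]
    constructor
    · rintro ⟨hw, hlt⟩
      rw [← PNat.coe_lt_coe, G.lab_eq, G.lab_eq] at hlt
      exact ⟨G.lab_pos_iff.2 hw, hlt⟩
    · rintro ⟨hw, hlt⟩
      refine ⟨G.lab_pos_iff.1 hw, ?_⟩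
      rwa [← PNat.coe_lt_coe, G.lab_eq, G.lab_eq]
  simp only [IsConditioningVertex, mem_cond, ← key]
  constructor
  · intro H
    exact ⟨H a (Sym2.mem_mk_left _ _), H b (Sym2.mem_mk_right _ _)⟩
  · rintro ⟨ha, hb⟩ w hw
    rcases Sym2.mem_iff.1 hw with rfl | rfl
    exacts [ha, hb]

/-- The principal clique of the edge `ab`, as a function of the endvertices. -/
def clq (a b : G.Vertex) : Set G.Vertex := insert a (insert b (G.cond a b))

theorem clq_comm (a b : G.Vertex) : G.clq a b = G.clq b a := by
  rw [clq, clq, G.cond_comm a b, Set.insert_comm]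

theorem left_mem_clq (a b : G.Vertex) : a ∈ G.clq a b := .inl rfl

theorem right_mem_clq (a b : G.Vertex) : b ∈ G.clq a b := .inr (.inl rfl)

theorem principalClique_eq {a b : G.Vertex} (he : s(a, b) ∈ G.graph.edgeSet) :
    G.principalClique ⟨s(a, b), he⟩ = G.clq a b := by
  ext w
  simp only [principalClique, clq, Set.mem_union, Set.mem_insert_iff, Set.mem_ofPred_eq,
    Sym2.mem_iff, G.isConditioningVertex_iff he, or_assoc]

theorem clq_sdiff_eq {a b : G.Vertex} (hab : 0 < G.lab a b) :
    G.clq a b \ {b} = insert a (G.cond a b) := by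
  ext x
  simp only [clq, Set.mem_sdiff, Set.mem_insert_iff, Set.mem_singleton_iff]
  have := G.right_notMem_cond a b
  have := G.ne_of_lab_pos hab
  constructor
  · tauto
  · rintro (rfl | h)
    · tauto
    · exact ⟨.inr (.inr h), fun h' => by subst h'; contradiction⟩

/-- The properties of an edge-labeled graph from which chordality and the poset structure of the
principal cliques are derived. Compared with `IsMAT`, the condition on cycles is replaced by a bound
on cliques and by the absence of cycles of edges with the same conditioning vertices. -/
structure IsWeakMAT : Prop where
  triangles : ∀ a b, 0 < G.lab a b → (G.cond a b).ncard + 1 = G.lab a b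
  clique : ∀ k, 1 ≤ k → ∀ C : Set G.Vertex, (G.below k).IsClique C → C.ncard ≤ k
  sparse : ∀ a b, 0 < G.lab a b → ¬ ReflTransGen (fun x y => G.lab x y = G.lab a b ∧
    s(x, y) ≠ s(a, b) ∧ G.cond x y = G.cond a b) a b

end Labels

/-! ### Chordality of the graphs of small labels -/

namespace IsWeakMAT

variable {G : EdgeLabeledGraph.{u}} (hG : G.IsWeakMAT) {k : ℕ} {a b : G.Vertex}

theorem isClique_cond_aux (hH : IsChordal (G.below (G.lab a b))) (hab : 0 < G.lab a b) :
    (G.below (G.lab a b)).IsClique (G.cond a b) := by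
  intro m hm n hn hmn
  exact hH.adj_of_adj (fun h => lt_irrefl _ h.2) (G.ne_of_lab_pos hab) hmn hm.1 hm.2 hn.1 hn.2

include hG

/-- Below level `k`, the vertices completing a given clique of size `k - 1` to a clique of size `k`
lie in different components of the complement of that clique: by chordality, a walk between two of
them could be chosen among such vertices, and its first step would give a clique of size
`k + 1`. -/
theorem eq_of_connIn (hk : 1 ≤ k) (hH : IsChordal (G.below k)) {N : Set G.Vertex}
    (hN : (G.below k).IsClique N) (hcard : N.ncard + 1 = k) {x y : G.Vertex}
    (hx : ∀ s ∈ N, (G.below k).Adj s x) (hy : ∀ s ∈ N, (G.below k).Adj s y)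
    (h : ConnIn (G.below k) Nᶜ x y) : x = y := by
  have hxN : x ∉ N := fun h => (G.below k).loopless.irrefl _ (hx x h)
  have hyN : y ∉ N := fun h => (G.below k).loopless.irrefl _ (hy y h)
  have h' := hH.connIn_common (W := Nᶜ) N.toFinite (fun s hs hs' => hs' hs) hxN hyN hx hy h
  rcases ReflTransGen.cases_head h' with h | ⟨z, ⟨hadj, -, hzN, hz⟩, -⟩
  · exact h
  · have hz : ∀ s ∈ N, (G.below k).Adj s z := hz
    have hxz : x ∉ insert z N := by
      rintro (rfl | h)
      exacts [(G.below k).loopless.irrefl _ hadj, hxN h]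
    have hcl : (G.below k).IsClique (insert x (insert z N)) := by
      rw [SimpleGraph.isClique_insert, SimpleGraph.isClique_insert]
      refine ⟨⟨hN, fun s hs _ => (hz s hs).symm⟩, ?_⟩
      rintro s (rfl | hs) _
      exacts [hadj, (hx s hs).symm]
    have := hG.clique k hk _ hcl
    rw [Set.ncard_insert_of_notMem hxz, Set.ncard_insert_of_notMem hzN] at this
    omega

/-- The conditioning vertices of an edge `ab` of label `k` separate `a` from `b` in every graph
made of the edges of label smaller than `k` and of edges of label `k` other than `ab`. Indeed, an
edge of label `k` which joins two components of the complement of `cond a b` has the same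
conditioning vertices as `ab`, so a walk from `a` to `b` would give a chain of such edges. -/
theorem not_connIn_cond (hab : 0 < G.lab a b) (hH : IsChordal (G.below (G.lab a b)))
    {F : SimpleGraph G.Vertex}
    (hF : ∀ x y, F.Adj x y → G.lab x y = G.lab a b ∧ s(x, y) ≠ s(a, b)) :
    ¬ ConnIn (G.below (G.lab a b) ⊔ F) (G.cond a b)ᶜ a b := by
  intro h
  have hcl := isClique_cond_aux hH hab
  have hcard := hG.triangles a b hab
  have key : ∀ x, ConnIn (G.below (G.lab a b) ⊔ F) (G.cond a b)ᶜ a x →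
      ∃ y, (∀ s ∈ G.cond a b, (G.below (G.lab a b)).Adj s y) ∧
        ConnIn (G.below (G.lab a b)) (G.cond a b)ᶜ y x ∧
        ReflTransGen (fun x y => G.lab x y = G.lab a b ∧ s(x, y) ≠ s(a, b) ∧
          G.cond x y = G.cond a b) a y := by
    intro x hx
    induction hx with
    | refl => exact ⟨a, fun s hs => hs.1, .refl _, .refl⟩
    | @tail x x' _ hs ih =>
      obtain ⟨y, hy, hyx, hay⟩ := ih
      obtain ⟨hadj, hx, hx'⟩ := hs
      by_cases hxx' : ConnIn (G.below (G.lab a b)) (G.cond a b)ᶜ x x'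
      · exact ⟨y, hy, hyx.trans hxx', hay⟩
      have hFadj : F.Adj x x' := by
        rcases hadj with hadj | hadj
        exacts [(hxx' (.of_adj hadj hx hx')).elim, hadj]
      obtain ⟨hlab, hne⟩ := hF _ _ hFadj
      have hsub : G.cond x x' ⊆ G.cond a b := by
        intro s hs
        by_contra hs'
        rw [cond, hlab] at hs
        exact hxx' (.trans (.of_adj hs.1.symm hx hs') (.of_adj hs.2 hs' hx'))
      have hcard' := hG.triangles x x' (hlab ▸ hab)
      have heq : G.cond x x' = G.cond a b :=
        Set.eq_of_subset_of_ncard_le hsub (by omega) (Set.toFinite _)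
      have hends : ∀ s ∈ G.cond a b, (G.below (G.lab a b)).Adj s x ∧
          (G.below (G.lab a b)).Adj s x' := by
        intro s hs
        rwa [← heq, cond, hlab] at hs
      obtain rfl := hG.eq_of_connIn hab hH hcl hcard hy (fun s hs => (hends s hs).1) hyx
      exact ⟨x', fun s hs => (hends s hs).2, .refl _, hay.tail ⟨hlab, hne, heq⟩⟩
  obtain ⟨y, hy, hyb, hay⟩ := key b h
  obtain rfl := hG.eq_of_connIn hab hH hcl hcard hy (fun s hs => hs.2) hyb
  exact hG.sparse a y hab hay

theorem isChordal_sup (hk : 1 ≤ k) (hH : IsChordal (G.below k)) {T : Set (Sym2 G.Vertex)}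
    (hT : ∀ x y, s(x, y) ∈ T → G.lab x y = k) :
    IsChordal (G.below k ⊔ SimpleGraph.fromEdgeSet T) := by
  induction T, T.toFinite using Set.Finite.induction_on with
  | empty => simpa using hH
  | @insert e T he _ ih =>
    induction e using Sym2.ind with
    | _ a b =>
      have hlab := hT a b (.inl rfl)
      subst hlab
      have hch := ih fun x y hxy => hT x y (.inr hxy)
      have hne : a ≠ b := G.ne_of_lab_pos hk
      refine hch.add_edge (a := a) (b := b) ?_ hne ?_
      · intro x y
        simp only [SimpleGraph.sup_adj, SimpleGraph.fromEdgeSet_adj, Set.mem_insert_iff,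
          Sym2.eq_iff]
        constructor
        · tauto
        · rintro ((h | h) | ⟨rfl, rfl⟩ | ⟨rfl, rfl⟩)
          · exact .inl h
          · exact .inr ⟨.inr h.1, h.2⟩
          · exact .inr ⟨.inl (.inl ⟨rfl, rfl⟩), hne⟩
          · exact .inr ⟨.inl (.inr ⟨rfl, rfl⟩), hne.symm⟩
      · intro hc
        refine hG.not_connIn_cond hk hH (F := SimpleGraph.fromEdgeSet T) ?_ (hc.mono le_rfl ?_)
        · intro x y hxy
          rw [SimpleGraph.fromEdgeSet_adj] at hxy
          exact ⟨hT x y (.inr hxy.1), fun h => he (h ▸ hxy.1)⟩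
        · exact Set.compl_subset_compl.2 fun s hs => ⟨.inl hs.1, .inl hs.2⟩

theorem isChordal_below (k : ℕ) : IsChordal (G.below k) := by
  induction k with
  | zero => exact isChordal_of_forall_not_adj fun x y h => Nat.not_lt_zero _ h.2
  | succ k ih =>
    rcases Nat.eq_zero_or_pos k with rfl | hk
    · exact isChordal_of_forall_not_adj fun x y h => by have := h.1; have := h.2; omega
    · have := hG.isChordal_sup hk ih (T := {e | e ∈ G.graph.edgeSet ∧ ∀ x y, e = s(x, y) →
        G.lab x y = k}) fun x y h => h.2 x y rfl
      convert this using 1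
      ext x y
      simp only [SimpleGraph.sup_adj, SimpleGraph.fromEdgeSet_adj, Set.mem_ofPred_eq,
        below_adj, ← lab_pos_iff]
      constructor
      · rintro ⟨h1, h2⟩
        rcases Nat.lt_succ_iff_lt_or_eq.1 h2 with h | h
        · exact .inl ⟨h1, h⟩
        · refine .inr ⟨⟨h1, fun x' y' he => ?_⟩, G.ne_of_lab_pos h1⟩
          rw [← h, G.lab_congr he]
      · rintro (⟨h1, h2⟩ | ⟨⟨h1, h2⟩, -⟩)
        · exact ⟨h1, by omega⟩
        · exact ⟨h1, by have := h2 x y rfl; omega⟩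

/-- The conditioning vertices of an edge `ab` separate `a` from `b` in the graph of the edges other
than `ab` whose labels are at most the label of `ab`. -/
theorem separates (hab : 0 < G.lab a b) :
    ¬ ReflTransGen (fun x y => (0 < G.lab x y ∧ G.lab x y ≤ G.lab a b ∧ s(x, y) ≠ s(a, b)) ∧
      x ∉ G.cond a b ∧ y ∉ G.cond a b) a b := by
  intro h
  let F : SimpleGraph G.Vertex :=
    { Adj x y := G.lab x y = G.lab a b ∧ s(x, y) ≠ s(a, b)
      symm := ⟨fun x y h => by rwa [G.lab_comm y x, Sym2.eq_swap]⟩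
      loopless := ⟨fun x h => by have := h.1; simp at this; omega⟩ }
  refine hG.not_connIn_cond hab (hG.isChordal_below _) (F := F) (fun x y h => h)
    (ReflTransGen.mono ?_ _ _ h)
  rintro x y ⟨⟨h1, h2, h3⟩, h4⟩
  refine ⟨?_, h4⟩
  rcases h2.lt_or_eq with h2 | h2
  exacts [.inl ⟨h1, h2⟩, .inr ⟨h2, h3⟩]

/-! ### Principal cliques -/

theorem isClique_cond (hab : 0 < G.lab a b) :
    (G.below (G.lab a b)).IsClique (G.cond a b) :=
  isClique_cond_aux (hG.isChordal_below _) hab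

theorem ncard_clq (hab : 0 < G.lab a b) : (G.clq a b).ncard = G.lab a b + 1 := by
  rw [clq, Set.ncard_insert_of_notMem, Set.ncard_insert_of_notMem (G.right_notMem_cond a b),
    hG.triangles a b hab]
  rintro (h | h)
  exacts [G.ne_of_lab_pos hab h, G.left_notMem_cond a b h]

theorem lab_of_mem_clq (hab : 0 < G.lab a b) {x y : G.Vertex} (hx : x ∈ G.clq a b)
    (hy : y ∈ G.clq a b) (hxy : x ≠ y) (hne : s(x, y) ≠ s(a, b)) :
    0 < G.lab x y ∧ G.lab x y < G.lab a b := by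
  rcases hx with rfl | rfl | hx <;> rcases hy with rfl | rfl | hy
  · exact (hxy rfl).elim
  · exact (hne rfl).elim
  · rw [G.lab_comm]; exact hy.1
  · exact (hne Sym2.eq_swap).elim
  · exact (hxy rfl).elim
  · rw [G.lab_comm]; exact hy.2
  · exact hx.1
  · exact hx.2
  · exact hG.isClique_cond hab hx hy hxy

end IsWeakMAT

/-- The nonempty cliques all of whose labels are smaller than their cardinality. They turn out to be
the singletons and the principal cliques. -/
def IsNode (G : EdgeLabeledGraph.{u}) (C : Set G.Vertex) : Prop :=
  C.Nonempty ∧ (G.below C.ncard).IsClique C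

theorem isNode_singleton (G : EdgeLabeledGraph.{u}) (i : G.Vertex) : G.IsNode {i} :=
  ⟨Set.singleton_nonempty i, by simp⟩

namespace IsWeakMAT

variable {G : EdgeLabeledGraph.{u}} (hG : G.IsWeakMAT) {a b : G.Vertex} {C D : Set G.Vertex}
include hG

theorem isNode_clq (hab : 0 < G.lab a b) : G.IsNode (G.clq a b) := by
  refine ⟨⟨a, G.left_mem_clq a b⟩, fun x hx y hy hxy => ?_⟩
  rw [hG.ncard_clq hab, below_adj]
  by_cases h : s(x, y) = s(a, b)
  · rw [G.lab_congr h]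
    omega
  · have := hG.lab_of_mem_clq hab hx hy hxy h
    omega

/-- A clique whose cardinality exceeds the label of one of its edges `ab` by `1`, all labels being
at most this label, is the principal clique of `ab`: each further vertex joins `a` to `b`, hence
belongs to the separator `cond a b`. -/
theorem eq_clq (hC : G.IsNode C) (ha : a ∈ C) (hb : b ∈ C) (hcard : G.lab a b + 1 = C.ncard)
    (hne : a ≠ b) : C = G.clq a b := by
  have hab : 0 < G.lab a b := (hC.2 ha hb hne).1
  refine Set.eq_of_subset_of_ncard_le ?_ (by rw [hG.ncard_clq hab]; omega) (Set.toFinite _)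
  intro c hc
  by_contra hcK
  simp only [clq, Set.mem_insert_iff, not_or] at hcK
  obtain ⟨hca, hcb, hcN⟩ := hcK
  have h1 := hC.2 ha hc (Ne.symm hca)
  have h2 := hC.2 hc hb hcb
  rw [below_adj] at h1 h2
  refine hG.separates hab (.tail (.tail .refl ⟨⟨h1.1, by omega, ?_⟩, G.left_notMem_cond a b, hcN⟩)
    ⟨⟨h2.1, by omega, ?_⟩, hcN, G.right_notMem_cond a b⟩)
  · simp [hcb]
    tauto
  · simp [hca]
    tauto

theorem exists_eq_clq (hC : G.IsNode C) (h2 : 2 ≤ C.ncard) :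
    ∃ a b, 0 < G.lab a b ∧ G.lab a b + 1 = C.ncard ∧ C = G.clq a b := by
  have : ∃ a ∈ C, ∃ b ∈ C, a ≠ b ∧ G.lab a b + 1 = C.ncard := by
    by_contra hcon
    push Not at hcon
    have := hG.clique (C.ncard - 1) (by omega) C fun x hx y hy hxy => by
      have h1 := hC.2 hx hy hxy
      have h2 := hcon x hx y hy hxy
      rw [below_adj] at h1 ⊢
      omega
    omega
  obtain ⟨a, ha, b, hb, hne, hcard⟩ := this
  exact ⟨a, b, (hC.2 ha hb hne).1, hcard, hG.eq_clq hC ha hb hcard hne⟩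

theorem isNode_iff : G.IsNode C ↔ (∃ i, C = {i}) ∨ ∃ a b, 0 < G.lab a b ∧ C = G.clq a b := by
  constructor
  · intro hC
    rcases Nat.lt_or_ge C.ncard 2 with h | h
    · have := (Set.ncard_pos C.toFinite).2 hC.1
      exact .inl (Set.ncard_eq_one.1 (by omega))
    · obtain ⟨a, b, hab, -, h⟩ := hG.exists_eq_clq hC h
      exact .inr ⟨a, b, hab, h⟩
  · rintro (⟨i, rfl⟩ | ⟨a, b, hab, rfl⟩)
    exacts [G.isNode_singleton i, hG.isNode_clq hab]

theorem ncard_clq_sdiff (hab : 0 < G.lab a b) : (G.clq a b \ {a}).ncard = G.lab a b := by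
  have := Set.ncard_sdiff_singleton_add_one (G.left_mem_clq a b) (Set.toFinite _)
  rw [hG.ncard_clq hab] at this
  omega

theorem isNode_clq_sdiff (hab : 0 < G.lab a b) : G.IsNode (G.clq a b \ {a}) := by
  refine ⟨⟨b, G.right_mem_clq a b, (G.ne_of_lab_pos hab).symm⟩, fun x hx y hy hxy => ?_⟩
  rw [hG.ncard_clq_sdiff hab]
  refine hG.lab_of_mem_clq hab hx.1 hy.1 hxy fun h => ?_
  rcases Sym2.eq_iff.1 h with ⟨h, -⟩ | ⟨-, h⟩
  exacts [hx.2 h, hy.2 h]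

theorem not_subset_of_ssubset (hab : 0 < G.lab a b) (hC : G.IsNode C) (h : C ⊂ G.clq a b) :
    a ∉ C ∨ b ∉ C := by
  by_contra! hcon
  have h1 := hC.2 hcon.1 hcon.2 (G.ne_of_lab_pos hab)
  have h2 := Set.ncard_lt_ncard h (Set.toFinite _)
  rw [hG.ncard_clq hab] at h2
  rw [below_adj] at h1
  omega

/-- A node containing the endvertices of an edge contains its principal clique. -/
theorem clq_subset (hC : G.IsNode C) (ha : a ∈ C) (hb : b ∈ C) (hne : a ≠ b) :
    G.clq a b ⊆ C := by
  induction hn : C.ncard using Nat.strong_induction_on generalizing C with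
  | _ n ih =>
    subst hn
    have h2 : 2 ≤ C.ncard := by
      rw [← Set.ncard_pair hne]
      exact Set.ncard_le_ncard (Set.insert_subset ha (Set.singleton_subset_iff.2 hb))
        (Set.toFinite _)
    obtain ⟨c, d, hcd, -, rfl⟩ := hG.exists_eq_clq hC h2
    have step : ∀ c d, 0 < G.lab c d → c ≠ a → c ≠ b →
        a ∈ G.clq c d → b ∈ G.clq c d →
        (∀ m < (G.clq c d).ncard, ∀ {C : Set G.Vertex}, G.IsNode C → a ∈ C → b ∈ C →
          C.ncard = m → G.clq a b ⊆ C) → G.clq a b ⊆ G.clq c d := by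
      intro c d hcd hca hcb ha hb ih
      refine (ih _ ?_ (hG.isNode_clq_sdiff hcd) ⟨ha, hca.symm⟩ ⟨hb, hcb.symm⟩ rfl).trans
        Set.sdiff_subset
      rw [hG.ncard_clq hcd, hG.ncard_clq_sdiff hcd]
      omega
    by_cases hc : c = a ∨ c = b
    · by_cases hd : d = a ∨ d = b
      · have := G.ne_of_lab_pos hcd
        rcases hc with rfl | rfl <;> rcases hd with rfl | rfl
        · exact (this rfl).elim
        · exact subset_rfl
        · rw [G.clq_comm]
        · exact (this rfl).elim
      · rw [not_or] at hd
        rw [G.clq_comm c d] at ha hb ih ⊢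
        exact step d c (G.lab_comm c d ▸ hcd) hd.1 hd.2 ha hb ih
    · rw [not_or] at hc
      exact step c d hcd hc.1 hc.2 ha hb ih

/-- The conditioning vertices of an edge of label at least `2` form a node. The two nodes obtained
from the principal clique of `ab` by removing an endvertex are distinct, so the edge of largest
label in `cond a b ∪ {a}` is not contained in both of them and hence contains `a`. -/
theorem isNode_cond (hab : 2 ≤ G.lab a b) : G.IsNode (G.cond a b) := by
  have hpos : 0 < G.lab a b := by omega
  have hpos' : 0 < G.lab b a := by rwa [G.lab_comm]
  have e1 := G.clq_sdiff_eq hpos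
  have e2 := G.clq_sdiff_eq hpos'
  have n1 : G.IsNode (insert a (G.cond a b)) := by
    rw [← e1, G.clq_comm]
    exact hG.isNode_clq_sdiff hpos'
  have n2 : G.IsNode (insert b (G.cond a b)) := by
    rw [G.cond_comm, ← e2, G.clq_comm]
    exact hG.isNode_clq_sdiff hpos
  have hcond := hG.triangles a b hpos
  have c1 := Set.ncard_insert_of_notMem (G.left_notMem_cond a b)
  have c2 := Set.ncard_insert_of_notMem (G.right_notMem_cond a b)
  obtain ⟨c, d, hcd, hcard, hC⟩ := hG.exists_eq_clq n1 (by omega)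
  have hcm : c ∈ insert a (G.cond a b) := hC ▸ G.left_mem_clq c d
  have hdm : d ∈ insert a (G.cond a b) := hC ▸ G.right_mem_clq c d
  have done : ∀ d, 0 < G.lab a d → insert a (G.cond a b) = G.clq a d →
      G.IsNode (G.cond a b) := by
    intro d had h
    have := hG.isNode_clq_sdiff had
    rwa [← h, Set.insert_sdiff_self_of_notMem (G.left_notMem_cond a b)] at this
  rcases hcm with rfl | hcm
  · exact done d hcd hC
  rcases hdm with rfl | hdm
  · exact done c (by rwa [G.lab_comm]) (by rw [hC, G.clq_comm])
  have heq := hG.eq_clq n2 (.inr hcm) (.inr hdm) (by omega) (G.ne_of_lab_pos hcd)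
  have hb : b ∈ insert a (G.cond a b) := by
    rw [hC, ← heq]
    exact .inl rfl
  rcases hb with hb | hb
  exacts [(G.ne_of_lab_pos hpos hb.symm).elim, (G.right_notMem_cond a b hb).elim]

end IsWeakMAT

end EdgeLabeledGraph

/-! ### Comparison with MAT-labelings -/

namespace EdgeLabeledGraph

open Relation

section Cycles

variable {G : EdgeLabeledGraph.{u}} {a b : G.Vertex}

theorem exists_cycle_iff (he : s(a, b) ∈ G.graph.edgeSet) (k : ℕ+) :
    (∃ (x : G.Vertex) (c : G.graph.Walk x x), c.IsCycle ∧ s(a, b) ∈ c.edges ∧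
      ∀ f : G.graph.edgeSet, (f : Sym2 G.Vertex) ∈ c.edges → f ≠ ⟨s(a, b), he⟩ → G.label f = k) ↔
    ReflTransGen (fun x y => G.lab x y = k ∧ s(x, y) ≠ s(a, b)) a b := by
  let K : SimpleGraph G.Vertex :=
    { Adj x y := G.graph.Adj x y ∧ (s(x, y) ≠ s(a, b) → G.lab x y = k)
      symm := ⟨fun x y h => ⟨h.1.symm, by rw [Sym2.eq_swap, G.lab_comm]; exact h.2⟩⟩
      loopless := ⟨fun x h => G.graph.loopless.irrefl x h.1⟩ }
  have hK : K ≤ G.graph := fun x y h => h.1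
  have hmem : ∀ x y, s(x, y) ∈ K.edgeSet ↔
      s(x, y) ∈ G.graph.edgeSet ∧ (s(x, y) ≠ s(a, b) → G.lab x y = k) := fun x y => Iff.rfl
  have hdel : ∀ x y, (K.deleteEdges {s(a, b)}).Adj x y ↔
      G.lab x y = k ∧ s(x, y) ≠ s(a, b) := by
    intro x y
    rw [SimpleGraph.deleteEdges_adj, Set.mem_singleton_iff, ← SimpleGraph.mem_edgeSet, hmem,
      ← G.lab_pos_iff]
    constructor
    · rintro ⟨⟨-, h⟩, h'⟩
      exact ⟨h h', h'⟩
    · rintro ⟨h, h'⟩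
      exact ⟨⟨h ▸ k.pos, fun _ => h⟩, h'⟩
  have hreach : (K.deleteEdges {s(a, b)}).Reachable a b ↔
      ReflTransGen (fun x y => G.lab x y = k ∧ s(x, y) ≠ s(a, b)) a b := by
    rw [SimpleGraph.reachable_iff_reflTransGen]
    constructor <;> exact ReflTransGen.mono (fun x y h => by simpa only [hdel] using h) _ _
  have hadj : K.Adj a b := ⟨he, fun h => (h rfl).elim⟩
  rw [← hreach, ← and_iff_right (a := K.Adj a b) hadj (b := (K.deleteEdges _).Reachable a b),
    SimpleGraph.adj_and_reachable_delete_edges_iff_exists_cycle]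
  constructor
  · rintro ⟨x, c, hc, hab, hf⟩
    have hcK : ∀ e ∈ c.edges, e ∈ K.edgeSet := by
      intro e
      induction e using Sym2.ind with
      | _ x y =>
        intro hxy
        have hG := c.edges_subset_edgeSet hxy
        refine (hmem x y).2 ⟨hG, fun hne => ?_⟩
        rw [← G.lab_eq hG, hf ⟨_, hG⟩ hxy fun h => hne (congrArg Subtype.val h)]
    exact ⟨x, c.transfer K hcK, hc.transfer hcK, by rwa [SimpleGraph.Walk.edges_transfer]⟩
  · rintro ⟨x, c, hc, hab⟩
    refine ⟨x, c.mapLe hK, (SimpleGraph.Walk.isCycle_mapLe hK).2 hc, ?_, ?_⟩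
    · rwa [SimpleGraph.Walk.edges_mapLe_eq_edges]
    · rintro ⟨e, hG⟩
      rw [SimpleGraph.Walk.edges_mapLe_eq_edges]
      induction e using Sym2.ind with
      | _ x y =>
        intro hxy hne
        have := ((hmem x y).1 (c.edges_subset_edgeSet hxy)).2 fun h => hne (Subtype.ext h)
        rwa [← G.lab_eq hG, PNat.coe_inj] at this

end Cycles

namespace IsMAT

variable {G : EdgeLabeledGraph.{u}} (hG : G.IsMAT)
include hG

theorem not_chain {a b : G.Vertex} (hab : 0 < G.lab a b) {k : ℕ} (hk : G.lab a b ≤ k) :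
    ¬ ReflTransGen (fun x y => G.lab x y = k ∧ s(x, y) ≠ s(a, b)) a b := by
  have he := G.lab_pos_iff.1 hab
  lift k to ℕ+ using hab.trans_le hk
  have hle : G.label ⟨s(a, b), he⟩ ≤ k := by rwa [← PNat.coe_le_coe, G.lab_eq]
  exact fun h => hG.no_cycle k ⟨_, he⟩ hle ((exists_cycle_iff he k).2 h)

theorem ncard_cond {a b : G.Vertex} (hab : 0 < G.lab a b) :
    (G.cond a b).ncard + 1 = G.lab a b := by
  have he := G.lab_pos_iff.1 hab
  rw [← G.lab_eq he, ← hG.triangles ⟨_, he⟩]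
  congr 2
  ext h
  exact (G.isConditioningVertex_iff he).symm

/-- An MAT-labeled graph satisfies the clique bound: the edges of label `k` inside a clique of
edges of label at most `k` form a matching, so such a clique is either contained in the principal
clique of one of its edges or has only labels smaller than `k`. -/
theorem isWeakMAT : G.IsWeakMAT where
  triangles _ _ hab := hG.ncard_cond hab
  clique k hk := by
    induction k, hk using Nat.le_induction with
    | base =>
      intro C hC
      rw [Set.ncard_le_one C.toFinite]
      intro a ha b hb
      by_contra hne
      have := hC ha hb hne
      rw [below_adj] at this
      omega
    | succ k hk ih =>
      intro C hC
      by_cases h : ∃ a ∈ C, ∃ b ∈ C, G.lab a b = k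
      · obtain ⟨a, ha, b, hb, hab⟩ := h
        have hpos : 0 < G.lab a b := by omega
        -- two edges of label `k` with a common endvertex would form a triangle with a third edge
        have lt : ∀ a b c, a ∈ C → b ∈ C → c ∈ C → c ≠ a → c ≠ b → G.lab a b = k →
            0 < G.lab c a ∧ G.lab c a < G.lab a b := by
          intro a b c ha hb hc hca hcb hab
          have h1 := hC hc ha hca
          have h2 := hC hc hb hcb
          rw [below_adj] at h1 h2
          refine ⟨h1.1, lt_of_le_of_ne (by omega) fun heq => ?_⟩
          have hne : a ≠ b := G.ne_of_lab_pos (by omega)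
          refine hG.not_chain h2.1 (k := k) (by omega)
            (.tail (.single (b := a) ⟨heq.trans hab, ?_⟩) ⟨hab, ?_⟩)
          · simp [hne]
            tauto
          · simp [hca.symm]
            tauto
        have hsub : C ⊆ G.clq a b := by
          intro c hc
          by_cases hca : c = a
          · exact .inl hca
          by_cases hcb : c = b
          · exact .inr (.inl hcb)
          have h2 := lt b a c hb ha hc hcb hca (by rwa [G.lab_comm])
          rw [G.lab_comm b a] at h2
          exact .inr (.inr ⟨lt a b c ha hb hc hca hcb hab, h2⟩)
        have h1 := Set.ncard_le_ncard hsub (Set.toFinite _)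
        have h2 : (G.clq a b).ncard ≤ _ := Set.ncard_insert_le _ _
        have h3 := Set.ncard_insert_le b (G.cond a b)
        have h4 := hG.ncard_cond hpos
        omega
      · push Not at h
        refine (ih C fun x hx y hy hxy => ?_).trans (Nat.le_succ k)
        have h1 := hC hx hy hxy
        have h2 := h x hx y hy
        rw [below_adj] at h1 ⊢
        omega
  sparse a b hab h :=
    hG.not_chain hab le_rfl (ReflTransGen.mono (fun _ _ h => ⟨h.1, h.2.1⟩) _ _ h)

end IsMAT

namespace IsWeakMAT

variable {G : EdgeLabeledGraph.{u}} (hG : G.IsWeakMAT)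

/-- The graph of the edges of label `k`. -/
def level (G : EdgeLabeledGraph.{u}) (k : ℕ) : SimpleGraph G.Vertex where
  Adj x y := 0 < G.lab x y ∧ G.lab x y = k
  symm := ⟨fun x y h => by rwa [G.lab_comm y x]⟩
  loopless := ⟨fun x h => by simp at h⟩

include hG

/-- A path of edges of label `k` is not closed to a cycle by an edge of smaller label. In a shortest
such cycle, the conditioning vertices of an edge of label `k` do not occur, since they are joined to
its endvertices by edges of smaller label, so the rest of the cycle contradicts the separation
property of that edge. -/
theorem not_isPath {k : ℕ} {i j : G.Vertex} (p : (level G k).Walk i j) (hp : p.IsPath)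
    (h0 : 0 < G.lab i j) (hk : G.lab i j < k) : False := by
  classical
  induction hn : p.length using Nat.strong_induction_on generalizing i j with
  | _ n ih =>
    subst hn
    cases p with
    | nil => simp at h0
    | @cons _ x _ hix q =>
      rw [SimpleGraph.Walk.cons_isPath_iff] at hp
      obtain ⟨hq, hi⟩ := hp
      have hxi : G.lab x i = k := by rw [G.lab_comm]; exact hix.2
      have hsupp : ∀ t ∈ q.support, t ∉ G.cond x i := by
        intro t ht hcond
        have hlt := hcond.1
        rw [below_adj, hxi, G.lab_comm] at hlt
        exact ih _ (Nat.lt_succ_of_le (q.length_takeUntil_le_length ht)) (q.takeUntil t ht)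
          (hq.takeUntil ht) hlt.1 hlt.2 rfl
      have hconn := ConnIn.of_walk (W := {t | t ∉ G.cond x i ∧ t ≠ i}) q
        fun t ht => ⟨hsupp t ht, fun h => hi (h ▸ ht)⟩
      refine hG.separates (a := x) (b := i) (by omega) (.tail (b := j) (ReflTransGen.mono ?_ _ _
        hconn) ⟨⟨?_, ?_, fun h => ?_⟩, hsupp j q.end_mem_support, G.right_notMem_cond x i⟩)
      · rintro u v ⟨huv, hu, hv⟩
        refine ⟨⟨huv.1, (huv.2.trans hxi.symm).le, fun h => ?_⟩, hu.1, hv.1⟩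
        rcases Sym2.eq_iff.1 h with ⟨-, h⟩ | ⟨h, -⟩
        exacts [hv.2 h, hu.2 h]
      · rwa [G.lab_comm]
      · rw [G.lab_comm j i]
        omega
      · have := G.lab_congr h
        rw [G.lab_comm j i] at this
        omega

theorem isMAT : G.IsMAT where
  no_cycle := by
    classical
    rintro k ⟨e, he⟩ hk
    induction e using Sym2.ind with
    | _ a b =>
      have hpos := G.lab_pos_iff.2 he
      rw [exists_cycle_iff]
      rw [← PNat.coe_le_coe, G.lab_eq] at hk
      intro h
      let F : SimpleGraph G.Vertex := (level G k).deleteEdges {s(a, b)}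
      have hF : ∀ x y, F.Adj x y ↔ G.lab x y = k ∧ s(x, y) ≠ s(a, b) := by
        intro x y
        simp only [F, SimpleGraph.deleteEdges_adj, Set.mem_singleton_iff, level]
        have := k.pos
        constructor
        · rintro ⟨⟨-, h⟩, h'⟩
          exact ⟨h, h'⟩
        · rintro ⟨h, h'⟩
          exact ⟨⟨by omega, h⟩, h'⟩
      have hFle : F ≤ level G k := SimpleGraph.deleteEdges_le _
      have hreach : F.Reachable a b := by
        rw [SimpleGraph.reachable_iff_reflTransGen]
        exact ReflTransGen.mono (fun x y h => (hF x y).2 h) _ _ h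
      obtain ⟨p, hp⟩ := hreach.exists_isPath
      rcases hk.lt_or_eq with hlt | heq
      · exact hG.not_isPath (p.mapLe hFle) ((SimpleGraph.Walk.isPath_mapLe hFle).2 hp) hpos hlt
      · by_cases hn : ∃ n ∈ p.support, n ∈ G.cond a b
        · obtain ⟨n, hn, hcond⟩ := hn
          have hlt := hcond.1
          rw [below_adj, G.lab_comm, heq] at hlt
          exact hG.not_isPath ((p.takeUntil n hn).mapLe hFle)
            ((SimpleGraph.Walk.isPath_mapLe hFle).2 (hp.takeUntil hn)) hlt.1 hlt.2
        · push Not at hn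
          refine hG.separates hpos (ReflTransGen.mono ?_ _ _ (ConnIn.of_walk (W := (G.cond a b)ᶜ)
            p fun t ht => hn t ht))
          rintro x y ⟨hxy, hx, hy⟩
          rw [hF] at hxy
          exact ⟨⟨by have := k.pos; omega, by omega, hxy.2⟩, hx, hy⟩
  triangles := by
    rintro ⟨e, he⟩
    induction e using Sym2.ind with
    | _ a b =>
      rw [G.lab_eq, ← hG.triangles a b (G.lab_pos_iff.2 he)]
      congr 2
      ext h
      exact G.isConditioningVertex_iff he

end IsWeakMAT

end EdgeLabeledGraph

/-! ### Rank functions and vines -/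

section VineLemmas

variable {P : Type u} [PartialOrder P] {rk : P → ℕ}

namespace IsRankFunction

variable (h : IsRankFunction rk)
include h

theorem mono {x y : P} (hxy : x ≤ y) : rk x ≤ rk y := by
  rcases hxy.lt_or_eq with hxy | rfl
  exacts [(h.strictMono _ _ hxy).le, le_rfl]

theorem eq_of_le {x y : P} (hxy : x ≤ y) (hr : rk y ≤ rk x) : x = y := by
  rcases hxy.lt_or_eq with hxy | hxy
  · have := h.strictMono _ _ hxy
    omega
  · exact hxy

theorem covBy_of_lt {x y : P} (hxy : x < y) (hr : rk y ≤ rk x + 1) : x ⋖ y := by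
  refine ⟨hxy, fun z hxz hzy => ?_⟩
  have h1 := h.strictMono _ _ hxz
  have h2 := h.strictMono _ _ hzy
  omega

variable [Finite P]

theorem exists_rank_eq (v : P) {i : ℕ} (hi : 1 ≤ i) (hv : i ≤ rk v) : ∃ z ≤ v, rk z = i := by
  induction hn : rk v using Nat.strong_induction_on generalizing v with
  | _ n ih =>
    subst hn
    rcases hv.lt_or_eq with hlt | heq
    · have hmin : ¬ IsMin v := fun hm => by
        have := h.isMin v hm
        omega
      obtain ⟨y, hy⟩ := not_isMin_iff.1 hmin
      obtain ⟨a, -, ha⟩ := exists_le_covBy_of_lt hy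
      have hra := h.covBy _ _ ha
      obtain ⟨z, hz, hr⟩ := ih (rk a) (by omega) a (by omega) rfl
      exact ⟨z, hz.trans ha.le, hr⟩
    · exact ⟨v, le_rfl, heq.symm⟩

theorem one_le (x : P) : 1 ≤ rk x := by
  obtain ⟨m, hm, hmin⟩ : ∃ m ≤ x, IsMin m := by
    obtain ⟨m, hm, hmin⟩ := (Set.toFinite (Set.Iic x)).exists_minimal ⟨x, le_rfl⟩
    exact ⟨m, hm, fun y hy => hmin (hy.trans hm) hy⟩
  rw [← h.isMin m hmin]
  exact h.mono hm

theorem isMin_iff {x : P} : IsMin x ↔ rk x = 1 := by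
  refine ⟨h.isMin x, fun hx y hy => ?_⟩
  have := h.one_le y
  exact (h.eq_of_le hy (by omega)).ge

end IsRankFunction

theorem exists_mem_coveredSet_of_lt [Finite P] {x v : P} (h : x < v) :
    ∃ a ∈ coveredSet v, x ≤ a := by
  obtain ⟨a, hx, ha⟩ := exists_le_covBy_of_lt h
  exact ⟨a, ha, hx⟩

theorem le_or_le_of_lt [Finite P] {x v a b : P} (hv : coveredSet v = {a, b}) (h : x < v) :
    x ≤ a ∨ x ≤ b := by
  obtain ⟨c, hc, hx⟩ := exists_mem_coveredSet_of_lt h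
  rw [hv] at hc
  rcases hc with rfl | rfl
  exacts [.inl hx, .inr hx]

theorem left_covBy {v a b : P} (hv : coveredSet v = {a, b}) : a ⋖ v := by
  have : a ∈ coveredSet v := by simp [hv]
  exact this

theorem right_covBy {v a b : P} (hv : coveredSet v = {a, b}) : b ⋖ v := by
  have : b ∈ coveredSet v := by simp [hv]
  exact this

namespace IsVine

variable (h : IsVine rk)
include h

theorem exists_coveredSet_eq {v : P} (hv : ¬ IsMin v) :
    ∃ a b, a ≠ b ∧ coveredSet v = {a, b} :=
  Set.ncard_eq_two.1 (h.covers_two v hv)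

theorem coveredSet_eq {a b v : P} (hne : a ≠ b) (ha : a ⋖ v) (hb : b ⋖ v) :
    coveredSet v = {a, b} := by
  have h2 := h.covers_two v fun hm => ha.lt.not_ge (hm ha.le)
  have hfin : (coveredSet v).Finite := Set.finite_of_ncard_ne_zero (by omega)
  refine (Set.eq_of_subset_of_ncard_le ?_ ?_ hfin).symm
  · rintro x (rfl | rfl)
    exacts [ha, hb]
  · rw [Set.ncard_pair hne, h2]

theorem isAcyclic [Finite P] {i : ℕ} (hi : 1 ≤ i) : (associatedForest rk i).IsAcyclic := by
  intro x c hc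
  refine h.forest i hi ?_ c hc
  conv_lhs => rw [← x.2]
  exact le_ciSup (Set.finite_range rk).bddAbove x.1

end IsVine

/-- The graph on all elements of rank `i` whose edges are the sets of elements covered by the
elements of rank `i + 1` below `c`: the `i`-th associated graph of the principal ideal of `c`,
extended by isolated nodes. -/
def idealForest (rk : P → ℕ) (c : P) (i : ℕ) : SimpleGraph {x : P // rk x = i} where
  Adj a b := a ≠ b ∧ ∃ v ≤ c, rk v = i + 1 ∧ coveredSet v = {a.1, b.1}
  symm := ⟨fun a b ⟨hab, v, hvc, hv, hc⟩ => ⟨hab.symm, v, hvc, hv, by rw [hc, Set.pair_comm]⟩⟩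
  loopless := ⟨fun _ h => h.1 rfl⟩

theorem idealForest_le (c : P) (i : ℕ) : idealForest rk c i ≤ associatedForest rk i :=
  fun _ _ ⟨hne, v, _, hv, hc⟩ => ⟨hne, v, hv, hc⟩

theorem idealForest_mono {c d : P} (hcd : c ≤ d) (i : ℕ) :
    idealForest rk c i ≤ idealForest rk d i :=
  fun _ _ ⟨hne, v, hvc, hv, hc⟩ => ⟨hne, v, hvc.trans hcd, hv, hc⟩

theorem le_of_idealForest_adj {c : P} {i : ℕ} {x y : {x : P // rk x = i}}
    (h : (idealForest rk c i).Adj x y) : x.1 ≤ c ∧ y.1 ≤ c := by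
  obtain ⟨-, v, hv, -, hc⟩ := h
  exact ⟨(left_covBy hc).le.trans hv, (right_covBy hc).le.trans hv⟩

/-! ### Principal ideals -/

section Ideal

variable {c : P}

theorem ideal_covBy_iff {x y : {x : P // x ≤ c}} : x ⋖ y ↔ x.1 ⋖ y.1 := by
  constructor
  · intro h
    refine ⟨h.lt, fun z hxz hzy => ?_⟩
    exact h.2 (c := ⟨z, hzy.le.trans y.2⟩) hxz hzy
  · intro h
    exact ⟨h.lt, fun z hxz hzy => h.2 (c := z.1) hxz hzy⟩

theorem ideal_isMin_iff {x : {x : P // x ≤ c}} : IsMin x ↔ IsMin x.1 := by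
  constructor
  · intro h y hy
    exact h (b := ⟨y, hy.trans x.2⟩) hy
  · intro h y hy
    exact h (b := y.1) hy

theorem image_coveredSet_ideal (v : {x : P // x ≤ c}) :
    Subtype.val '' coveredSet v = coveredSet v.1 := by
  ext x
  constructor
  · rintro ⟨y, hy, rfl⟩
    exact ideal_covBy_iff.1 hy
  · intro hx
    exact ⟨⟨x, CovBy.le hx |>.trans v.2⟩, ideal_covBy_iff.2 hx, rfl⟩

theorem ideal_coveredSet_eq_iff {v a b : {x : P // x ≤ c}} :
    coveredSet v = {a, b} ↔ coveredSet v.1 = {a.1, b.1} := by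
  rw [← image_coveredSet_ideal, ← Set.image_pair]
  exact (Set.image_injective.2 Subtype.val_injective).eq_iff.symm

theorem ncard_isMin_ideal :
    {x : {x : P // x ≤ c} | IsMin x}.ncard = (completeUnion c).ncard := by
  rw [← Set.ncard_image_of_injective _ Subtype.val_injective]
  congr 1
  ext x
  constructor
  · rintro ⟨y, hy, rfl⟩
    exact ⟨ideal_isMin_iff.1 hy, y.2⟩
  · intro hx
    exact ⟨⟨x, hx.2⟩, ideal_isMin_iff.2 hx.1, rfl⟩

theorem IsRankFunction.iSup_ideal [Finite P] (h : IsRankFunction rk) (c : P) :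
    ⨆ x : {x : P // x ≤ c}, rk x.1 = rk c := by
  have : Nonempty {x : P // x ≤ c} := ⟨⟨c, le_rfl⟩⟩
  refine le_antisymm (ciSup_le fun x => h.mono x.2) ?_
  exact le_ciSup (f := fun x : {x : P // x ≤ c} => rk x.1) (Set.finite_range _).bddAbove
    ⟨c, le_rfl⟩

theorem ideal_adj_iff {i : ℕ} {x y : {x : {x : P // x ≤ c} // rk x.1 = i}} :
    (associatedForest (fun x : {x : P // x ≤ c} => rk x.1) i).Adj x y ↔
      (idealForest rk c i).Adj ⟨x.1.1, x.2⟩ ⟨y.1.1, y.2⟩ := by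
  constructor
  · rintro ⟨hne, v, hv, hc⟩
    refine ⟨fun h => hne (Subtype.ext (Subtype.ext (Subtype.mk.inj h))), v.1, v.2, hv, ?_⟩
    exact ideal_coveredSet_eq_iff.1 hc
  · rintro ⟨hne, v, hvc, hv, hc⟩
    refine ⟨fun h => hne (by rw [h]), ⟨v, hvc⟩, hv, ?_⟩
    exact ideal_coveredSet_eq_iff.2 hc

theorem ideal_reachable_iff {i : ℕ} {x y : {x : {x : P // x ≤ c} // rk x.1 = i}} :
    (associatedForest (fun x : {x : P // x ≤ c} => rk x.1) i).Reachable x y ↔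
      (idealForest rk c i).Reachable ⟨x.1.1, x.2⟩ ⟨y.1.1, y.2⟩ := by
  constructor
  · rintro ⟨p⟩
    induction p with
    | nil => exact .refl _
    | cons h _ ih => exact (ideal_adj_iff.1 h).reachable.trans ih
  · rintro ⟨p⟩
    have key : ∀ {x y : {x : P // rk x = i}}, (idealForest rk c i).Walk x y →
        ∀ (hx : x.1 ≤ c) (hy : y.1 ≤ c),
        (associatedForest (fun x : {x : P // x ≤ c} => rk x.1) i).Reachable
          ⟨⟨x.1, hx⟩, x.2⟩ ⟨⟨y.1, hy⟩, y.2⟩ := by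
      intro x y p
      induction p with
      | nil => exact fun _ _ => .refl _
      | cons h _ ih =>
        intro hx hy
        have hz := (le_of_idealForest_adj h).2
        exact (SimpleGraph.Adj.reachable (ideal_adj_iff.2 h)).trans (ih hz hy)
    exact key p x.1.2 y.1.2

variable [Finite P]

theorem IsVine.ideal (h : IsVine rk) (c : P) : IsVine fun x : {x : P // x ≤ c} => rk x.1 where
  isRank :=
    { strictMono x y hxy := h.isRank.strictMono _ _ hxy
      covBy x y hxy := h.isRank.covBy _ _ (ideal_covBy_iff.1 hxy)
      isMin x hx := h.isRank.isMin _ (ideal_isMin_iff.1 hx) }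
  covers_two v hv := by
    rw [← h.covers_two v.1 (fun hm => hv (ideal_isMin_iff.2 hm)), ← image_coveredSet_ideal,
      Set.ncard_image_of_injective _ Subtype.val_injective]
  covered_unique a b hne hr v w hav hbv haw hbw := by
    refine Subtype.ext (h.covered_unique a.1 b.1 (fun hab => hne (Subtype.ext hab)) hr v.1 w.1 ?_
      ?_ ?_ ?_) <;> rwa [← ideal_covBy_iff]
  forest i hi _ := by
    let f : associatedForest (fun x : {x : P // x ≤ c} => rk x.1) i →g associatedForest rk i :=
      { toFun x := ⟨x.1.1, x.2⟩
        map_rel' hxy := idealForest_le c i (ideal_adj_iff.1 hxy) }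
    refine (h.isAcyclic hi).comap f fun x y hxy => ?_
    exact Subtype.ext (Subtype.ext (Subtype.mk.inj hxy))

end Ideal

variable [Finite P]

/-- In a vine satisfying the proximity condition, the associated graphs of principal ideals are
connected: an element `c` covers two elements `a`, `b`, and the ideals of `a` and `b` share elements
of every rank below `rk a` by proximity. -/
theorem IsVine.reachable_idealForest (h : IsVine rk)
    (hprox : ∀ a b : P, a ≠ b → rk a = rk b → 2 ≤ rk a → (∃ v, a ⋖ v ∧ b ⋖ v) →
      ∃ c, c ⋖ a ∧ c ⋖ b)
    (c : P) {i : ℕ} (hi : 1 ≤ i) (x y : {x : P // rk x = i}) (hx : x.1 ≤ c) (hy : y.1 ≤ c) :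
    (idealForest rk c i).Reachable x y := by
  induction hn : rk c using Nat.strong_induction_on generalizing c x y with
  | _ n ih =>
    subst hn
    have hxr := x.2
    have hyr := y.2
    rcases (h.isRank.mono hx).lt_or_eq with hlt | heq
    · rw [hxr] at hlt
      have hmin : ¬ IsMin c := fun hm => by
        have := h.isRank.isMin c hm
        omega
      obtain ⟨a, b, hab, hc⟩ := h.exists_coveredSet_eq hmin
      have ha := left_covBy hc
      have hb := right_covBy hc
      have hra := h.isRank.covBy _ _ ha
      have hrb := h.isRank.covBy _ _ hb
      have hxc := le_or_le_of_lt hc (lt_of_le_of_ne hx fun h => by rw [h] at hxr; omega)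
      have hyc := le_or_le_of_lt hc (lt_of_le_of_ne hy fun h => by rw [h] at hyr; omega)
      rcases Nat.lt_or_ge i (rk a) with hia | hia
      · obtain ⟨d, hda, hdb⟩ := hprox a b hab (by omega) (by omega) ⟨c, ha, hb⟩
        have hrd := h.isRank.covBy _ _ hda
        obtain ⟨z, hz, hzr⟩ := h.isRank.exists_rank_eq d hi (by omega)
        have key : ∀ x : {x : P // rk x = i}, x.1 ≤ a ∨ x.1 ≤ b →
            (idealForest rk c i).Reachable x ⟨z, hzr⟩ := by
          rintro x (hx | hx)
          · exact (ih (rk a) (by omega) a x ⟨z, hzr⟩ hx (hz.trans hda.le) rfl).mono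
              (idealForest_mono ha.le i)
          · exact (ih (rk b) (by omega) b x ⟨z, hzr⟩ hx (hz.trans hdb.le) rfl).mono
              (idealForest_mono hb.le i)
        exact (key x hxc).trans (key y hyc).symm
      · have key : ∀ x : {x : P // rk x = i}, x.1 ≤ a ∨ x.1 ≤ b → x.1 = a ∨ x.1 = b := by
          intro x hx
          have hxr := x.2
          rcases hx with hx | hx
          · exact .inl (h.isRank.eq_of_le hx (by omega))
          · exact .inr (h.isRank.eq_of_le hx (by omega))
        by_cases hxy : x = y
        · rw [hxy]
        · have hxy' : x.1 ≠ y.1 := fun h => hxy (Subtype.ext h)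
          refine SimpleGraph.Adj.reachable ⟨hxy, c, le_rfl, by omega, ?_⟩
          rw [hc]
          rcases key x hxc with h1 | h1 <;> rcases key y hyc with h2 | h2
          · exact (hxy' (h1.trans h2.symm)).elim
          · rw [h1, h2]
          · rw [h1, h2, Set.pair_comm]
          · exact (hxy' (h1.trans h2.symm)).elim
    · have h1 := h.isRank.eq_of_le hx heq.ge
      have h2 := h.isRank.eq_of_le hy (by omega)
      rw [Subtype.ext (h1.trans h2.symm)]

/-- Local regularity reduces to the proximity condition and the number of minimal elements below
each element. -/
theorem IsVine.isLRVine (h : IsVine rk)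
    (hprox : ∀ a b : P, a ≠ b → rk a = rk b → 2 ≤ rk a → (∃ v, a ⋖ v ∧ b ⋖ v) →
      ∃ c, c ⋖ a ∧ c ⋖ b)
    (hcard : ∀ a : P, (completeUnion a).ncard = rk a) : IsLRVine rk where
  isVine := h
  ideal c :=
    { isVine := h.ideal c
      rank_eq_dim := by rw [h.isRank.iSup_ideal, ncard_isMin_ideal, hcard]
      tree i hi hic := by
        rw [h.isRank.iSup_ideal] at hic
        obtain ⟨z, hz, hzr⟩ := h.isRank.exists_rank_eq c hi hic
        have : Nonempty {x : {x : P // x ≤ c} // rk x.1 = i} := ⟨⟨⟨z, hz⟩, hzr⟩⟩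
        refine ⟨⟨fun x y => ?_⟩, (h.ideal c).isAcyclic hi⟩
        exact ideal_reachable_iff.2 (h.reachable_idealForest hprox c hi _ _ x.1.2 y.1.2)
      proximity a b hne hr h2 hv := by
        obtain ⟨v, hav, hbv⟩ := hv
        obtain ⟨d, hda, hdb⟩ := hprox a.1 b.1 (fun hab => hne (Subtype.ext hab)) hr h2
          ⟨v.1, ideal_covBy_iff.1 hav, ideal_covBy_iff.1 hbv⟩
        exact ⟨⟨d, hda.le.trans a.2⟩, ideal_covBy_iff.2 hda, ideal_covBy_iff.2 hdb⟩ }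

namespace IsLRVine

variable (h : IsLRVine rk)
include h

theorem ncard_completeUnion (v : P) : (completeUnion v).ncard = rk v := by
  rw [← ncard_isMin_ideal, ← (h.ideal v).rank_eq_dim, h.isVine.isRank.iSup_ideal]

theorem reachable_idealForest (c : P) {i : ℕ} (hi : 1 ≤ i) (x y : {x : P // rk x = i})
    (hx : x.1 ≤ c) (hy : y.1 ≤ c) : (idealForest rk c i).Reachable x y := by
  have htree := (h.ideal c).tree i hi (by
    rw [h.isVine.isRank.iSup_ideal, ← x.2]
    exact h.isVine.isRank.mono hx)
  exact ideal_reachable_iff.1 (htree.connected.preconnected ⟨⟨x.1, hx⟩, x.2⟩ ⟨⟨y.1, hy⟩, y.2⟩)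

end IsLRVine

end VineLemmas

/-! ### The poset of principal cliques -/

namespace EdgeLabeledGraph.IsWeakMAT

open Relation

variable {G : EdgeLabeledGraph.{u}} (hG : G.IsWeakMAT) {a b : G.Vertex}
include hG

theorem isNode_val (v : (psiPoset G).Node) : G.IsNode v.1 := by
  rcases v.2 with ⟨i, hi⟩ | ⟨⟨e, he⟩, hv⟩
  · rw [hi]
    exact G.isNode_singleton i
  · induction e using Sym2.ind with
    | _ a b =>
      rw [hv, G.principalClique_eq he]
      exact hG.isNode_clq (G.lab_pos_iff.2 he)

theorem exists_node {C : Set G.Vertex} (hC : G.IsNode C) : ∃ v : (psiPoset G).Node, v.1 = C := by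
  rcases hG.isNode_iff.1 hC with h | ⟨a, b, hab, rfl⟩
  · exact ⟨⟨C, .inl h⟩, rfl⟩
  · exact ⟨⟨G.clq a b, .inr ⟨⟨_, G.lab_pos_iff.1 hab⟩, (G.principalClique_eq _).symm⟩⟩, rfl⟩

/-- The removal of either endvertex of `ab` from the principal clique of `ab` gives an element of
the poset. -/
theorem exists_faces (hab : 0 < G.lab a b) : ∃ A B : (psiPoset G).Node,
    A.1 = G.clq a b \ {a} ∧ B.1 = G.clq a b \ {b} := by
  obtain ⟨A, hA⟩ := hG.exists_node (hG.isNode_clq_sdiff hab)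
  obtain ⟨B, hB⟩ := hG.exists_node (hG.isNode_clq_sdiff (a := b) (b := a) (by rwa [G.lab_comm]))
  exact ⟨A, B, hA, by rw [hB, G.clq_comm]⟩

omit hG in
theorem singleton_or_exists_clq (v : (psiPoset G).Node) :
    (∃ i, v.1 = {i}) ∨ ∃ a b, 0 < G.lab a b ∧ v.1 = G.clq a b := by
  rcases v.2 with h | ⟨⟨e, he⟩, hv⟩
  · exact .inl h
  · induction e using Sym2.ind with
    | _ a b => exact .inr ⟨a, b, G.lab_pos_iff.2 he, by rw [hv, G.principalClique_eq he]⟩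

theorem isMin_psi_iff {v : (psiPoset G).Node} : IsMin v ↔ ∃ i, v.1 = {i} := by
  constructor
  · intro hv
    rcases singleton_or_exists_clq v with h | ⟨a, b, hab, hvab⟩
    · exact h
    · obtain ⟨A, -, hA, -⟩ := hG.exists_faces hab
      have hAv : A ≤ v := by
        change A.1 ⊆ v.1
        rw [hA, hvab]
        exact Set.sdiff_subset
      have hmem : a ∈ v.1 := hvab ▸ G.left_mem_clq a b
      have : a ∈ A.1 := hv hAv hmem
      rw [hA] at this
      exact (this.2 rfl).elim
  · rintro ⟨i, hi⟩ w hw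
    have hsub : w.1 ⊆ {i} := hi ▸ hw
    change v.1 ⊆ w.1
    rw [hi]
    rcases Set.subset_singleton_iff_eq.1 hsub with h | h
    · exact ((hG.isNode_val w).1.ne_empty h).elim
    · rw [h]

omit hG in
theorem rank_psi_lt {v w : (psiPoset G).Node} (h : v < w) :
    (psiPoset G).rank v < (psiPoset G).rank w :=
  Set.ncard_lt_ncard (show v.1 ⊂ w.1 from h) (Set.toFinite _)

theorem coveredSet_psi (hab : 0 < G.lab a b) {v A B : (psiPoset G).Node} (hv : v.1 = G.clq a b)
    (hA : A.1 = G.clq a b \ {a}) (hB : B.1 = G.clq a b \ {b}) : coveredSet v = {A, B} := by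
  have key : ∀ {a b}, 0 < G.lab a b → ∀ {A}, v.1 = G.clq a b → A.1 = G.clq a b \ {a} → A ⋖ v := by
    intro a b hab A hv hA
    have hlt : A < v := by
      change A.1 ⊂ v.1
      rw [hA, hv]
      exact Set.sdiff_singleton_ssubset.2 (G.left_mem_clq a b)
    refine ⟨hlt, fun z hAz hzv => ?_⟩
    have h1 := rank_psi_lt hAz
    have h2 := rank_psi_lt hzv
    change A.1.ncard < z.1.ncard at h1
    change z.1.ncard < v.1.ncard at h2
    rw [hA, hG.ncard_clq_sdiff hab] at h1
    rw [hv, hG.ncard_clq hab] at h2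
    omega
  have hcA := key hab hv hA
  have hcB : B ⋖ v := key (a := b) (b := a) (by rwa [G.lab_comm]) (by rw [hv, G.clq_comm])
    (by rw [hB, G.clq_comm])
  ext x
  constructor
  · intro hx
    have hcov : x ⋖ v := hx
    have hlt : x.1 ⊂ v.1 := hcov.lt
    rw [hv] at hlt
    rcases hG.not_subset_of_ssubset hab (hG.isNode_val x) hlt with h | h
    · have hxA : x ≤ A := by
        change x.1 ⊆ A.1
        rw [hA]
        exact Set.subset_sdiff_singleton hlt.subset h
      exact .inl (hxA.lt_or_eq.resolve_left fun h => hx.2 h hcA.lt)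
    · have hxB : x ≤ B := by
        change x.1 ⊆ B.1
        rw [hB]
        exact Set.subset_sdiff_singleton hlt.subset h
      exact .inr (hxB.lt_or_eq.resolve_left fun h => hx.2 h hcB.lt)
  · rintro (rfl | rfl)
    exacts [hcA, hcB]

omit hG in
theorem faces_ne (hab : 0 < G.lab a b) {A B : (psiPoset G).Node}
    (hA : A.1 = G.clq a b \ {a}) (hB : B.1 = G.clq a b \ {b}) : A ≠ B := by
  rintro rfl
  have : a ∈ A.1 := by
    rw [hB]
    exact ⟨G.left_mem_clq a b, G.ne_of_lab_pos hab⟩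
  rw [hA] at this
  exact this.2 rfl

theorem isRankFunction_psi : IsRankFunction (psiPoset G).rank where
  strictMono _ _ h := rank_psi_lt h
  covBy x v hx := by
    rcases singleton_or_exists_clq v with h | ⟨a, b, hab, hv⟩
    · exact (hx.lt.not_ge ((hG.isMin_psi_iff.2 h) hx.le)).elim
    · obtain ⟨A, B, hA, hB⟩ := hG.exists_faces hab
      have hmem : x ∈ coveredSet v := hx
      rw [hG.coveredSet_psi hab hv hA hB] at hmem
      change v.1.ncard = x.1.ncard + 1
      rcases hmem with rfl | rfl
      · rw [hv, hA, hG.ncard_clq hab, hG.ncard_clq_sdiff hab]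
      · rw [hv, hB, G.clq_comm, hG.ncard_clq (by rwa [G.lab_comm]),
          hG.ncard_clq_sdiff (by rwa [G.lab_comm])]
  isMin v hv := by
    obtain ⟨i, hi⟩ := hG.isMin_psi_iff.1 hv
    change v.1.ncard = 1
    rw [hi, Set.ncard_singleton]

/-- An edge `x — y` of an associated graph comes from an edge `ab` of the graph, with
`x` and `y` the two faces of the principal clique. -/
theorem exists_of_coveredSet_eq {v x y : (psiPoset G).Node} (h : coveredSet v = {x, y}) :
    ∃ a b, 0 < G.lab a b ∧ v.1 = G.clq a b ∧ x.1 = G.clq a b \ {b} ∧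
      y.1 = G.clq a b \ {a} := by
  have hx := left_covBy h
  rcases singleton_or_exists_clq v with hv | ⟨a, b, hab, hv⟩
  · exact (hx.lt.not_ge ((hG.isMin_psi_iff.2 hv) hx.le)).elim
  · obtain ⟨A, B, hA, hB⟩ := hG.exists_faces hab
    have hAB := hG.coveredSet_psi hab hv hA hB
    rw [h] at hAB
    rcases Set.pair_eq_pair_iff.1 hAB with ⟨rfl, rfl⟩ | ⟨rfl, rfl⟩
    · refine ⟨b, a, by rwa [G.lab_comm], ?_, ?_, ?_⟩ <;> rw [G.clq_comm b a] <;> assumption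
    · exact ⟨a, b, hab, hv, hB, hA⟩

/-- The associated graphs of the poset of principal cliques are forests: along a walk avoiding the
edge given by `ab`, all vertices outside `cond a b` of the cliques met stay connected to `a` without
using `ab` and `cond a b`, whereas `cond a b` separates `a` from `b`. -/
theorem isAcyclic_psi (i : ℕ) : (associatedForest (psiPoset G).rank i).IsAcyclic := by
  rw [SimpleGraph.isAcyclic_iff_forall_adj_isBridge]
  rintro x y ⟨-, v, hvr, hvc⟩
  obtain ⟨a, b, hab, hv, hx, hy⟩ :=
    hG.exists_of_coveredSet_eq hvc
  have hlab : G.lab a b = i := by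
    change v.1.ncard = i + 1 at hvr
    rw [hv, hG.ncard_clq hab] at hvr
    omega
  rw [SimpleGraph.isBridge_iff]
  intro hreach
  rw [SimpleGraph.reachable_iff_reflTransGen] at hreach
  have key : ∀ z : {z : (psiPoset G).Node // (psiPoset G).rank z = i},
      ReflTransGen ((associatedForest (psiPoset G).rank i).deleteEdges {s(x, y)}).Adj x z →
      ∀ c ∈ z.1.1, c ∉ G.cond a b →
      ReflTransGen (fun x y => (0 < G.lab x y ∧ G.lab x y ≤ G.lab a b ∧ s(x, y) ≠ s(a, b)) ∧
        x ∉ G.cond a b ∧ y ∉ G.cond a b) a c := by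
    intro z hz
    induction hz with
    | refl =>
      intro c hc hcN
      rw [hx, G.clq_sdiff_eq hab] at hc
      rcases hc with rfl | hc
      exacts [.refl, (hcN hc).elim]
    | @tail z z' _ hzz' ih =>
      intro c hc hcN
      rw [SimpleGraph.deleteEdges_adj] at hzz'
      obtain ⟨⟨-, w, hwr, hwc⟩, hdel⟩ := hzz'
      obtain ⟨d, e, hde, hw, -, -⟩ :=
        hG.exists_of_coveredSet_eq hwc
      have hlab' : G.lab d e = i := by
        change w.1.ncard = i + 1 at hwr
        rw [hw, hG.ncard_clq hde] at hwr
        omega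
      have hneq : s(d, e) ≠ s(a, b) := by
        intro h
        have hvw : v = w := by
          refine Subtype.ext ?_
          rw [hv, hw]
          rcases Sym2.eq_iff.1 h with ⟨rfl, rfl⟩ | ⟨rfl, rfl⟩
          exacts [rfl, G.clq_comm _ _]
        rw [← hvw, hvc] at hwc
        refine hdel ?_
        rw [Set.mem_singleton_iff, Sym2.eq_iff]
        rcases Set.pair_eq_pair_iff.1 hwc with ⟨h1, h2⟩ | ⟨h1, h2⟩
        · exact .inl ⟨Subtype.ext h1.symm, Subtype.ext h2.symm⟩
        · exact .inr ⟨Subtype.ext h2.symm, Subtype.ext h1.symm⟩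
      -- by cardinality the clique `z` has a vertex outside `cond a b`
      obtain ⟨t, ht, htN⟩ : ∃ t ∈ z.1.1, t ∉ G.cond a b := by
        by_contra! hcon
        have h1 := Set.ncard_le_ncard (show z.1.1 ⊆ G.cond a b from hcon) (Set.toFinite _)
        have h2 := hG.triangles a b hab
        have h3 : z.1.1.ncard = i := z.2
        omega
      have hat := ih t ht htN
      by_cases htc : t = c
      · exact htc ▸ hat
      have htw : t ∈ G.clq d e := hw ▸ (left_covBy hwc).le ht
      have hcw : c ∈ G.clq d e := hw ▸ (right_covBy hwc).le hc
      refine hat.tail ⟨?_, htN, hcN⟩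
      by_cases hs : s(t, c) = s(d, e)
      · have := G.lab_congr hs
        exact ⟨by omega, by omega, hs ▸ hneq⟩
      · have := hG.lab_of_mem_clq hde htw hcw htc hs
        refine ⟨this.1, by omega, fun h => ?_⟩
        have := G.lab_congr h
        omega
  refine hG.separates hab (key y hreach b ?_ (G.right_notMem_cond a b))
  rw [hy]
  exact ⟨G.right_mem_clq a b, (G.ne_of_lab_pos hab).symm⟩

theorem isVine_psi : IsVine (psiPoset G).rank where
  isRank := hG.isRankFunction_psi
  covers_two v hv := by
    rcases singleton_or_exists_clq v with h | ⟨a, b, hab, hvab⟩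
    · exact (hv (hG.isMin_psi_iff.2 h)).elim
    · obtain ⟨A, B, hA, hB⟩ := hG.exists_faces hab
      rw [hG.coveredSet_psi hab hvab hA hB, Set.ncard_pair (faces_ne hab hA hB)]
  covered_unique a b hne hr v w hav hbv haw hbw := by
    have key : ∀ v, a ⋖ v → b ⋖ v → a.1 ∪ b.1 = v.1 := by
      intro v ha hb
      refine Set.eq_of_subset_of_ncard_le (Set.union_subset ha.le hb.le) ?_ (Set.toFinite _)
      have h1 := hG.isRankFunction_psi.covBy _ _ ha
      change v.1.ncard = a.1.ncard + 1 at h1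
      change a.1.ncard = b.1.ncard at hr
      have h2 : a.1 ⊂ a.1 ∪ b.1 := by
        refine Set.ssubset_iff_subset_ne.2 ⟨Set.subset_union_left, fun h => hne ?_⟩
        have hba : b.1 ⊆ a.1 := h ▸ Set.subset_union_right
        exact Subtype.ext (Set.eq_of_subset_of_ncard_le hba hr.le (Set.toFinite _)).symm
      have h3 := Set.ncard_lt_ncard h2 (Set.toFinite _)
      omega
    exact Subtype.ext ((key v hav hbv).symm.trans (key w haw hbw))
  forest i _ _ := hG.isAcyclic_psi i

theorem isLRVine_psi : IsLRVine (psiPoset G).rank := by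
  refine hG.isVine_psi.isLRVine ?_ ?_
  · rintro x y hne - h2 ⟨v, hx, hy⟩
    obtain ⟨a, b, hab, -, hx', hy'⟩ :=
      hG.exists_of_coveredSet_eq (hG.isVine_psi.coveredSet_eq hne hx hy)
    change 2 ≤ x.1.ncard at h2
    have hxr : x.1.ncard = G.lab a b := by
      rw [hx', G.clq_comm, hG.ncard_clq_sdiff (by rwa [G.lab_comm]), G.lab_comm]
    have hyr : y.1.ncard = G.lab a b := by
      rw [hy', hG.ncard_clq_sdiff hab]
    obtain ⟨c, hc⟩ := hG.exists_node (hG.isNode_cond (a := a) (b := b) (by omega))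
    have hcr : c.1.ncard + 1 = G.lab a b := by
      rw [hc]
      exact hG.triangles a b hab
    have key : ∀ z : (psiPoset G).Node, G.cond a b ⊆ z.1 → z.1.ncard = G.lab a b → c ⋖ z := by
      intro z hcz hz
      refine hG.isRankFunction_psi.covBy_of_lt (lt_of_le_of_ne (show c.1 ⊆ z.1 by rwa [hc]) ?_) ?_
      · rintro rfl
        omega
      · exact (show z.1.ncard ≤ c.1.ncard + 1 by omega)
    refine ⟨c, key x ?_ hxr, key y ?_ hyr⟩
    · rw [hx', G.clq_sdiff_eq hab]
      exact Set.subset_insert _ _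
    · rw [hy', G.clq_comm, G.clq_sdiff_eq (by rwa [G.lab_comm]), G.cond_comm b a]
      exact Set.subset_insert _ _
  · intro v
    change _ = v.1.ncard
    rw [← Set.ncard_image_of_injective v.1
      (f := fun i => (⟨{i}, .inl ⟨i, rfl⟩⟩ : (psiPoset G).Node))
      fun i j hij => Set.singleton_injective (congrArg Subtype.val hij)]
    congr 1
    ext w
    constructor
    · rintro ⟨hmin, hw⟩
      obtain ⟨i, hi⟩ := hG.isMin_psi_iff.1 hmin
      exact ⟨i, hw (by rw [hi]; rfl), Subtype.ext hi.symm⟩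
    · rintro ⟨i, hi, rfl⟩
      exact ⟨hG.isMin_psi_iff.2 ⟨i, rfl⟩, Set.singleton_subset_iff.2 hi⟩

/-- A principal clique which is the join of two elements has the endvertices of its edge in their
union. -/
theorem mem_union_of_isLUB {x y v : (psiPoset G).Node} (h : IsLUB {x, y} v)
    (hab : 0 < G.lab a b) (hv : v.1 = G.clq a b) : a ∈ x.1 ∪ y.1 := by
  by_contra hcon
  rw [Set.mem_union, not_or] at hcon
  obtain ⟨A, -, hA, -⟩ := hG.exists_faces hab
  have hub : A ∈ upperBounds {x, y} := by
    rintro z (rfl | rfl)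
    · change z.1 ⊆ A.1
      rw [hA, ← hv]
      exact Set.subset_sdiff_singleton (h.1 (.inl rfl)) hcon.1
    · change z.1 ⊆ A.1
      rw [hA, ← hv]
      exact Set.subset_sdiff_singleton (h.1 (.inr rfl)) hcon.2
  have hmem : a ∈ v.1 := hv ▸ G.left_mem_clq a b
  have : a ∈ A.1 := h.2 hub hmem
  rw [hA] at this
  exact this.2 rfl

/-- The principal clique of an edge is the join of the endvertices. -/
theorem isLUB_psi {v x y : (psiPoset G).Node} (hab : 0 < G.lab a b) (hx : x.1 = {a})
    (hy : y.1 = {b}) : IsLUB {x, y} v ↔ v.1 = G.clq a b := by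
  have key : ∀ v : (psiPoset G).Node, v.1 = G.clq a b → IsLUB {x, y} v := by
    intro v hv
    constructor
    · rintro z (rfl | rfl)
      · change z.1 ⊆ v.1
        rw [hx, hv, Set.singleton_subset_iff]
        exact G.left_mem_clq a b
      · change z.1 ⊆ v.1
        rw [hy, hv, Set.singleton_subset_iff]
        exact G.right_mem_clq a b
    · intro w hw
      have h1 : x.1 ⊆ w.1 := hw (.inl rfl)
      have h2 : y.1 ⊆ w.1 := hw (.inr rfl)
      rw [hx, Set.singleton_subset_iff] at h1
      rw [hy, Set.singleton_subset_iff] at h2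
      change v.1 ⊆ w.1
      rw [hv]
      exact hG.clq_subset (hG.isNode_val w) h1 h2 (G.ne_of_lab_pos hab)
  refine ⟨fun h => ?_, key v⟩
  obtain ⟨w, hw⟩ := hG.exists_node (hG.isNode_clq hab)
  rw [h.unique (key w hw), hw]

omit hG in
theorem lab_map {G' : EdgeLabeledGraph.{u}} (σ : Hom G G') {x y : G.Vertex}
    (h : 0 < G.lab x y) : G'.lab (σ.toFun x) (σ.toFun y) = G.lab x y := by
  obtain ⟨h', he⟩ := σ.map_edge x y (G.lab_pos_iff.1 h)
  rw [← G'.lab_eq h', he, G.lab_eq]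

omit hG in
theorem ncard_image_isNode {G' : EdgeLabeledGraph.{u}} (σ : Hom G G') {C : Set G.Vertex}
    (hC : G.IsNode C) : (σ.toFun '' C).ncard = C.ncard := by
  refine Set.InjOn.ncard_image fun x hx y hy hxy => ?_
  by_contra hne
  have h := (hC.2 hx hy hne).1
  rw [← lab_map σ h, hxy] at h
  simp at h

omit hG in
theorem isNode_image {G' : EdgeLabeledGraph.{u}} (σ : Hom G G') {C : Set G.Vertex}
    (hC : G.IsNode C) : G'.IsNode (σ.toFun '' C) := by
  refine ⟨hC.1.image _, ?_⟩
  rw [ncard_image_isNode σ hC]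
  rintro _ ⟨x, hx, rfl⟩ _ ⟨y, hy, rfl⟩ hne
  have h := hC.2 hx hy fun h => hne (by rw [h])
  rw [below_adj] at h ⊢
  rwa [lab_map σ h.1]

theorem exists_psi_map {G' : EdgeLabeledGraph.{u}} (hG' : G'.IsWeakMAT) (σ : Hom G G') :
    ∃ φ : RankedPoset.Hom (psiPoset G) (psiPoset G'),
      ∀ v, (φ.toFun v).1 = σ.toFun '' v.1 := by
  choose f hf using fun v => hG'.exists_node (isNode_image σ (hG.isNode_val v))
  have hmono : Monotone f := by
    intro v w hvw
    change (f v).1 ⊆ (f w).1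
    rw [hf, hf]
    exact Set.image_mono hvw
  refine ⟨⟨f, hmono, fun v => ?_, fun x y v h => ⟨?_, fun w hw => ?_⟩⟩, hf⟩
  · change (f v).1.ncard = v.1.ncard
    rw [hf, ncard_image_isNode σ (hG.isNode_val v)]
  · rintro z (rfl | rfl)
    exacts [hmono (h.1 (.inl rfl)), hmono (h.1 (.inr rfl))]
  · have hx : (f x).1 ⊆ w.1 := hw (.inl rfl)
    have hy : (f y).1 ⊆ w.1 := hw (.inr rfl)
    rw [hf] at hx hy
    change (f v).1 ⊆ w.1
    rw [hf]
    rcases singleton_or_exists_clq v with hv | ⟨a, b, hab, hv⟩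
    · have hxv : x = v := (h.1 (.inl rfl)).antisymm (hG.isMin_psi_iff.2 hv (h.1 (.inl rfl)))
      rwa [← hxv]
    · have hxy := Set.union_subset hx hy
      rw [← Set.image_union] at hxy
      have ha := hG.mem_union_of_isLUB h hab hv
      have hb := hG.mem_union_of_isLUB (a := b) (b := a) h (by rwa [G.lab_comm])
        (by rw [hv, G.clq_comm])
      have hpos : 0 < G'.lab (σ.toFun a) (σ.toFun b) := by rwa [lab_map σ hab]
      have hclq : σ.toFun '' v.1 = G'.clq (σ.toFun a) (σ.toFun b) := by
        refine hG'.eq_clq (isNode_image σ (hG.isNode_val v)) ⟨a, ?_, rfl⟩ ⟨b, ?_, rfl⟩ ?_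
          (G'.ne_of_lab_pos hpos)
        · rw [hv]; exact G.left_mem_clq a b
        · rw [hv]; exact G.right_mem_clq a b
        · rw [ncard_image_isNode σ (hG.isNode_val v), lab_map σ hab, hv, hG.ncard_clq hab]
      rw [hclq]
      exact hG'.clq_subset (hG'.isNode_val w) (hxy ⟨a, ha, rfl⟩) (hxy ⟨b, hb, rfl⟩)
        (G'.ne_of_lab_pos hpos)

end EdgeLabeledGraph.IsWeakMAT

/-! ### Subtrees of forests -/

section Forest

variable {V : Type*} {F H : SimpleGraph V} {x y z : V}

/-- In a forest `F`, if a walk leaves `x` towards `y` and never returns to `x`, then its first edge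
belongs to every subgraph in which `x` and `y` are connected. -/
theorem adj_of_isAcyclic (hF : F.IsAcyclic) (hH : H ≤ F) (hxz : F.Adj x z) (p : F.Walk z y)
    (hx : x ∉ p.support) (hr : H.Reachable x y) : H.Adj x z := by
  classical
  obtain ⟨r, hr⟩ := hr.exists_isPath
  have hp : (SimpleGraph.Walk.cons hxz p.bypass).IsPath :=
    SimpleGraph.Walk.cons_isPath_iff _ _ |>.2
      ⟨p.bypass_isPath, fun h => hx (p.support_bypass_subset_support h)⟩
  have heq := congrArg Subtype.val
    ((hF.subsingleton_path x y).elim ⟨_, hp⟩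
      ⟨r.mapLe hH, (SimpleGraph.Walk.isPath_mapLe hH).2 hr⟩)
  cases r with
  | nil => exact (hx p.end_mem_support).elim
  | cons h r =>
    obtain ⟨rfl, -⟩ := SimpleGraph.Walk.cons.inj heq
    exact h

theorem exists_first_step (hr : H.Reachable x y) (hne : x ≠ y) :
    ∃ z, H.Adj x z ∧ ∃ p : H.Walk z y, x ∉ p.support := by
  obtain ⟨r, hr⟩ := hr.exists_isPath
  cases r with
  | nil => exact (hne rfl).elim
  | cons h r =>
    rw [SimpleGraph.Walk.cons_isPath_iff] at hr
    exact ⟨_, h, r, hr.2⟩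

end Forest

/-! ### Joins in LR-vines -/

namespace IsLRVine

variable {P : Type u} [PartialOrder P] [Finite P] {rk : P → ℕ} (h : IsLRVine rk)
include h

/-- Let `x, y` be below `p` and `x, z` below `v`, where `x ≠ y`, `y` and `z` have the same rank `i`.
If `y` and `z` are connected in the `i`-th forest without using `x`, then the path from `x` to `y`
in the ideal of `p` and the path from `x` to `z` in the ideal of `v` start with the same edge, given
by an element of rank `i + 1` above `x` and below `p` and `v`. -/
theorem exists_common_edge {i : ℕ} (hi : 1 ≤ i) {x y z : {x : P // rk x = i}} {p v : P}
    (hxp : x.1 ≤ p) (hyp : y.1 ≤ p) (hxv : x.1 ≤ v) (hzv : z.1 ≤ v) (hxy : x ≠ y)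
    (w : (associatedForest rk i).Walk y z) (hw : x ∉ w.support) :
    ∃ e, rk e = i + 1 ∧ x.1 ≤ e ∧ e ≤ p ∧ e ≤ v := by
  obtain ⟨t, ht, q, hq⟩ := exists_first_step (h.reachable_idealForest p hi x y hxp hyp) hxy
  have hadj := adj_of_isAcyclic (h.isVine.isAcyclic hi) (idealForest_le v i)
    (idealForest_le p i ht) ((q.mapLe (idealForest_le p i)).append w)
    (by
      rw [SimpleGraph.Walk.mem_support_append_iff, SimpleGraph.Walk.support_mapLe_eq_support]
      exact not_or.2 ⟨hq, hw⟩)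
    (h.reachable_idealForest v hi x z hxv hzv)
  obtain ⟨hne, e, hep, he, hec⟩ := ht
  obtain ⟨-, f, hfv, -, hfc⟩ := hadj
  have hef : e = f := h.isVine.covered_unique x.1 t.1 (fun h => hne (Subtype.ext h))
    (x.2.trans t.2.symm) e f (left_covBy hec) (right_covBy hec) (left_covBy hfc) (right_covBy hfc)
  exact ⟨e, he, (left_covBy hec).le, hep, hef ▸ hfv⟩

/-- Two elements `x`, `y` of the same rank below both `v` and `w` have an upper bound below both `v`
and `w`: by uniqueness of paths the first and last edges of the path from `x` to `y` lie below `v`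
and `w`, which raises the rank. -/
theorem exists_between {x y v w : P} (hr : rk x = rk y) (hxv : x ≤ v) (hyv : y ≤ v) (hxw : x ≤ w)
    (hyw : y ≤ w) : ∃ z, x ≤ z ∧ y ≤ z ∧ z ≤ v ∧ z ≤ w := by
  induction hn : rk v - rk x generalizing x y with
  | zero =>
    have h1 := h.isVine.isRank.eq_of_le hxv (by omega)
    exact ⟨x, le_rfl, h1 ▸ hyv, hxv, hxw⟩
  | succ n ih =>
    by_cases hne : x = y
    · exact ⟨x, le_rfl, hne.ge, hxv, hxw⟩
    have hi := h.isVine.isRank.one_le y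
    have hne' : (⟨x, hr⟩ : {x : P // rk x = rk y}) ≠ ⟨y, rfl⟩ := fun h => hne (Subtype.mk.inj h)
    obtain ⟨e, he, hxe, hev, hew⟩ := h.exists_common_edge hi (x := ⟨x, hr⟩) (y := ⟨y, rfl⟩)
      (z := ⟨y, rfl⟩) hxv hyv hxw hyw hne' .nil (by simpa using hne)
    obtain ⟨f, hf, hyf, hfv, hfw⟩ := h.exists_common_edge hi (x := ⟨y, rfl⟩) (y := ⟨x, hr⟩)
      (z := ⟨x, hr⟩) hyv hxv hyw hxw hne'.symm .nil (by simpa using Ne.symm hne)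
    obtain ⟨z, hez, hfz, hz⟩ := ih (he.trans hf.symm) hev hfv hew hfw (by omega)
    exact ⟨z, hxe.trans hez, hyf.trans hfz, hz⟩

/-- A Helly property of principal ideals: for pairwise bounded elements `x`, `y`, `z` of the same
rank, one of the three given upper bounds is above all of them. -/
theorem helly {x y z p q v : P} (hxy : rk x = rk y) (hyz : rk y = rk z) (hxp : x ≤ p)
    (hzp : z ≤ p) (hyq : y ≤ q) (hzq : z ≤ q) (hxv : x ≤ v) (hyv : y ≤ v) :
    x ≤ q ∨ y ≤ p ∨ z ≤ v := by
  -- an element `x` not below `q` starts the paths to `z` and to `y` with the same edge, because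
  -- `y` and `z` are connected inside the ideal of `q`
  have key : ∀ {x y z p q v : P}, rk x = rk y → rk y = rk z → x ≤ p → z ≤ p → y ≤ q → z ≤ q →
      x ≤ v → y ≤ v → ¬ x ≤ q → ∃ e, rk e = rk x + 1 ∧ x ≤ e ∧ e ≤ p ∧ e ≤ v := by
    intro x y z p q v hxy hyz hxp hzp hyq hzq hxv hyv hxq
    have hi := h.isVine.isRank.one_le x
    obtain ⟨w⟩ := h.reachable_idealForest q hi ⟨z, (hxy.trans hyz).symm⟩ ⟨y, hxy.symm⟩ hzq hyq
    refine h.exists_common_edge hi (x := ⟨x, rfl⟩) hxp (y := ⟨z, (hxy.trans hyz).symm⟩) hzp hxv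
      (z := ⟨y, hxy.symm⟩) hyv (fun h => hxq ?_) (w.mapLe (idealForest_le q _)) ?_
    · rw [show x = z from Subtype.mk.inj h]
      exact hzq
    · have hsupp : ∀ {a b : {t : P // rk t = rk x}} (w : (idealForest rk q (rk x)).Walk a b),
          a.1 ≤ q → ∀ t ∈ w.support, t.1 ≤ q := by
        intro a b w
        induction w with
        | nil =>
          intro ha t ht
          rw [SimpleGraph.Walk.mem_support_nil_iff.1 ht]
          exact ha
        | cons hadj w ih =>
          intro ha t ht
          rcases List.mem_cons.1 ht with rfl | ht
          exacts [ha, ih (le_of_idealForest_adj hadj).2 t ht]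
      rw [SimpleGraph.Walk.support_mapLe_eq_support]
      exact fun hmem => hxq (hsupp w hzq _ hmem)
  induction hn : rk p - rk x generalizing x y z with
  | zero =>
    have h1 := h.isVine.isRank.eq_of_le hxp (by omega)
    have h2 := h.isVine.isRank.eq_of_le hzp (by omega)
    exact .inl ((h1.trans h2.symm).le.trans hzq)
  | succ n ih =>
    by_contra! hcon
    obtain ⟨hxq, hyp, hzv⟩ := hcon
    obtain ⟨e, he, hxe, hep, hev⟩ := key hxy hyz hxp hzp hyq hzq hxv hyv hxq
    obtain ⟨f, hf, hyf, hfv, hfq⟩ := key hyz (hxy.trans hyz).symm hyv hxv hzp hxp hyq hzq hyp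
    obtain ⟨g, hg, hzg, hgp, hgq⟩ := key hyz.symm hxy.symm hzp hxp hyv hxv hzq hyq hzv
    rcases ih (by omega) (by omega) hep hgp hfq hgq hev hfv (by omega) with h' | h' | h'
    · exact hxq (hxe.trans h')
    · exact hyp (hyf.trans h')
    · exact hzv (hzg.trans h')

theorem exists_isLUB {i j w : P} (hi : IsMin i) (hj : IsMin j) (hiw : i ≤ w) (hjw : j ≤ w) :
    ∃ v ≤ w, IsLUB {i, j} v := by
  obtain ⟨v, ⟨hiv, hjv, hvw⟩, hmin⟩ :=
    (Set.toFinite {v | i ≤ v ∧ j ≤ v ∧ v ≤ w}).exists_minimal ⟨w, hiw, hjw, le_rfl⟩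
  refine ⟨v, hvw, ?_, fun t ht => ?_⟩
  · rintro z (rfl | rfl)
    exacts [hiv, hjv]
  · have hr : rk i = rk j := by rw [h.isVine.isRank.isMin i hi, h.isVine.isRank.isMin j hj]
    obtain ⟨z, hiz, hjz, hzv, hzt⟩ := h.exists_between hr hiv hjv (ht (.inl rfl)) (ht (.inr rfl))
    exact (hmin ⟨hiz, hjz, hzv.trans hvw⟩ hzv).trans hzt

omit [Finite P] h in
theorem conditionedSet_eq {v a b : P} (hv : coveredSet v = {a, b}) :
    conditionedSet v = symmDiff (completeUnion a) (completeUnion b) := by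
  ext i
  constructor
  · rintro ⟨c, d, hcd, hi⟩
    rw [hv] at hcd
    rcases Set.pair_eq_pair_iff.1 hcd with ⟨rfl, rfl⟩ | ⟨rfl, rfl⟩
    · exact hi
    · rwa [symmDiff_comm]
  · exact fun hi => ⟨a, b, hv, hi⟩

omit h in
theorem completeUnion_eq_union {v a b : P} (hv : coveredSet v = {a, b}) :
    completeUnion v = completeUnion a ∪ completeUnion b := by
  ext i
  constructor
  · rintro ⟨hi, hiv⟩
    have hlt : i < v := lt_of_le_of_ne hiv fun h =>
      (left_covBy hv).lt.not_ge (h ▸ hi (h ▸ (left_covBy hv).le))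
    rcases le_or_le_of_lt hv hlt with h | h
    exacts [.inl ⟨hi, h⟩, .inr ⟨hi, h⟩]
  · rintro (⟨hi, h⟩ | ⟨hi, h⟩)
    exacts [⟨hi, h.trans (left_covBy hv).le⟩, ⟨hi, h.trans (right_covBy hv).le⟩]

/-- Of two elements covered by a common element, each has exactly one minimal element below it which
is not below the other one. -/
theorem exists_completeUnion_sdiff {v a b : P} (hv : coveredSet v = {a, b}) :
    ∃ i, completeUnion a \ completeUnion b = {i} := by
  rw [← Set.ncard_eq_one]
  have h1 := Set.ncard_sdiff_add_ncard (completeUnion a) (completeUnion b)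
  rw [← completeUnion_eq_union hv, h.ncard_completeUnion, h.ncard_completeUnion,
    h.isVine.isRank.covBy _ _ (right_covBy hv)] at h1
  omega

/-- The conditioned set of a non-minimal element `v` is a pair of minimal elements with join
`v`. -/
theorem exists_isLUB_eq {v : P} (hv : ¬ IsMin v) : ∃ i j, IsMin i ∧ IsMin j ∧ i ≠ j ∧
    IsLUB {i, j} v ∧ conditionedSet v = {i, j} := by
  obtain ⟨a, b, -, hc⟩ := h.isVine.exists_coveredSet_eq hv
  obtain ⟨i, hi⟩ := h.exists_completeUnion_sdiff hc
  obtain ⟨j, hj⟩ := h.exists_completeUnion_sdiff (Set.pair_comm a b ▸ hc)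
  obtain ⟨⟨hi0, hia⟩, hib⟩ : i ∈ completeUnion a \ completeUnion b := hi ▸ rfl
  obtain ⟨⟨hj0, hjb⟩, hja⟩ : j ∈ completeUnion b \ completeUnion a := hj ▸ rfl
  have hib : ¬ i ≤ b := fun h => hib ⟨hi0, h⟩
  have hja : ¬ j ≤ a := fun h => hja ⟨hj0, h⟩
  have hav := (left_covBy hc).le
  have hbv := (right_covBy hc).le
  refine ⟨i, j, hi0, hj0, ?_, ⟨?_, fun w hw => ?_⟩, ?_⟩
  · rintro rfl
    exact hib hjb
  · rintro z (rfl | rfl)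
    exacts [hia.trans hav, hjb.trans hbv]
  · have hr : rk i = rk j := by rw [h.isVine.isRank.isMin i hi0, h.isVine.isRank.isMin j hj0]
    obtain ⟨z, hiz, hjz, hzv, hzw⟩ := h.exists_between hr (hia.trans hav) (hjb.trans hbv)
      (hw (.inl rfl)) (hw (.inr rfl))
    rcases hzv.lt_or_eq with hlt | rfl
    · rcases le_or_le_of_lt hc hlt with h' | h'
      exacts [(hja (hjz.trans h')).elim, (hib (hiz.trans h')).elim]
    · exact hzw
  · rw [conditionedSet_eq hc, Set.symmDiff_def, hi, hj]
    rfl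

omit [Finite P] h in
theorem not_isMin_of_isLUB {i j v : P} (hne : i ≠ j)
    (hv : IsLUB {i, j} v) : ¬ IsMin v := by
  intro hm
  have h1 : i ≤ v := hv.1 (.inl rfl)
  have h2 : j ≤ v := hv.1 (.inr rfl)
  exact hne ((h1.antisymm (hm h1)).trans (h2.antisymm (hm h2)).symm)

/-- The two elements covered by the join of two minimal elements `i` and `j`. -/
theorem exists_faces {i j v : P} (hi : IsMin i) (hj : IsMin j) (hne : i ≠ j)
    (hv : IsLUB {i, j} v) : ∃ a b, a ≠ b ∧ coveredSet v = {a, b} ∧ i ≤ a ∧ j ≤ b ∧ ¬ i ≤ b ∧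
      ¬ j ≤ a ∧ conditionedSet v = {i, j} := by
  have hmin := not_isMin_of_isLUB hne hv
  have hiv : i < v := lt_of_le_of_ne (hv.1 (.inl rfl)) fun h => hmin (h ▸ hi)
  have hjv : j < v := lt_of_le_of_ne (hv.1 (.inr rfl)) fun h => hmin (h ▸ hj)
  obtain ⟨i', j', -, -, hne', -, hC⟩ := h.exists_isLUB_eq hmin
  obtain ⟨a, b, hab, hc⟩ := h.isVine.exists_coveredSet_eq hmin
  have not_both : ∀ a, a ⋖ v → ¬ (i ≤ a ∧ j ≤ a) := by
    rintro a ha ⟨h1, h2⟩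
    refine ha.lt.not_ge (hv.2 ?_)
    rintro z (rfl | rfl)
    exacts [h1, h2]
  have ha := not_both a (left_covBy hc)
  have hb := not_both b (right_covBy hc)
  have done : ∀ a b, a ≠ b → coveredSet v = {a, b} → i ≤ a → j ≤ b → ¬ i ≤ b → ¬ j ≤ a →
      ∃ a b, a ≠ b ∧ coveredSet v = {a, b} ∧ i ≤ a ∧ j ≤ b ∧ ¬ i ≤ b ∧
      ¬ j ≤ a ∧ conditionedSet v = {i, j} := by
    intro a b hab hc h1 h2 h3 h4
    refine ⟨a, b, hab, hc, h1, h2, h3, h4, ?_⟩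
    symm
    refine Set.eq_of_subset_of_ncard_le ?_ ?_ (Set.toFinite _)
    · rw [conditionedSet_eq hc]
      rintro z (rfl | rfl)
      exacts [.inl ⟨⟨hi, h1⟩, fun h => h3 h.2⟩, .inr ⟨⟨hj, h2⟩, fun h => h4 h.2⟩]
    · rw [hC, Set.ncard_pair hne, Set.ncard_pair hne']
  rcases le_or_le_of_lt hc hiv with h1 | h1 <;> rcases le_or_le_of_lt hc hjv with h2 | h2
  · exact (ha ⟨h1, h2⟩).elim
  · exact done a b hab hc h1 h2 (fun h => hb ⟨h, h2⟩) (fun h => ha ⟨h1, h⟩)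
  · exact done b a hab.symm (by rw [hc, Set.pair_comm]) h1 h2 (fun h => ha ⟨h, h2⟩)
      (fun h => hb ⟨h1, h⟩)
  · exact (hb ⟨h1, h2⟩).elim

omit h in
/-- A minimal element below `i ∨ j` other than `i` and `j` is below both elements covered by
`i ∨ j`. -/
theorem le_faces {i j k v a b : P} (hc : coveredSet v = {a, b})
    (hC : conditionedSet v = {i, j}) (hk : IsMin k) (hkv : k ≤ v) (hki : k ≠ i) (hkj : k ≠ j) :
    k ≤ a ∧ k ≤ b := by
  have h1 : k ∈ completeUnion a ∪ completeUnion b := by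
    rw [← completeUnion_eq_union hc]
    exact ⟨hk, hkv⟩
  have h2 : k ∉ symmDiff (completeUnion a) (completeUnion b) := by
    rw [← conditionedSet_eq hc, hC]
    rintro (h | h)
    exacts [hki h, hkj h]
  rw [Set.symmDiff_def] at h2
  by_contra hcon
  rcases h1 with h1 | h1
  · exact h2 (.inl ⟨h1, fun h => hcon ⟨h1.2, h.2⟩⟩)
  · exact h2 (.inr ⟨h1, fun h => hcon ⟨h.2, h1.2⟩⟩)

theorem le_of_completeUnion_subset {v w : P} (hvw : completeUnion v ⊆ completeUnion w) :
    v ≤ w := by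
  by_cases hv : IsMin v
  · exact (hvw ⟨hv, le_rfl⟩).2
  · obtain ⟨i, j, hi, hj, -, hlub, -⟩ := h.exists_isLUB_eq hv
    refine hlub.2 ?_
    rintro z (rfl | rfl)
    · exact (hvw ⟨hi, hlub.1 (.inl rfl)⟩).2
    · exact (hvw ⟨hj, hlub.1 (.inr rfl)⟩).2

end IsLRVine

/-! ### The edge-labeled graph of an LR-vine -/

namespace LRV

open Relation EdgeLabeledGraph

variable (P : LRV.{u})

theorem omega_lab_pos_iff {i j : (omegaGraph P).Vertex} :
    0 < (omegaGraph P).lab i j ↔ i ≠ j ∧ ∃ v, IsLUB {i.1, j.1} v :=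
  (omegaGraph P).lab_pos_iff

theorem ends_eq_pair {P : RankedPoset.{u}} (i j : {x : P.Node // IsMin x}) :
    {x : P.Node | ∃ k ∈ s(i, j), x = k.1} = {i.1, j.1} := by
  ext x
  simp

theorem omega_lab_eq {i j : (omegaGraph P).Vertex} (hne : i ≠ j) {v : P.Node}
    (hv : IsLUB {i.1, j.1} v) : (omegaGraph P).lab i j + 1 = P.rank v := by
  have he : s(i, j) ∈ (omegaGraph P).graph.edgeSet := ⟨hne, v, hv⟩
  rw [← (omegaGraph P).lab_eq he]
  obtain ⟨h1, h2⟩ := (exists_join_of_edge P ⟨s(i, j), he⟩).choose_spec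
  have heq := h1.unique ((congrArg (IsLUB · v) (ends_eq_pair i j)).mpr hv)
  change P.rank (exists_join_of_edge P ⟨s(i, j), he⟩).choose - 1 + 1 = P.rank v
  rw [heq] at h2 ⊢
  omega

theorem omega_exists_isLUB {i j : (omegaGraph P).Vertex} (h : 0 < (omegaGraph P).lab i j) :
    ∃ v, IsLUB {i.1, j.1} v ∧ (omegaGraph P).lab i j + 1 = P.rank v := by
  obtain ⟨hne, v, hv⟩ := (omega_lab_pos_iff P).1 h
  exact ⟨v, hv, omega_lab_eq P hne hv⟩

theorem omega_lab_lt {i j : (omegaGraph P).Vertex} (hne : i ≠ j) {w : P.Node} (hi : i.1 ≤ w)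
    (hj : j.1 ≤ w) : 0 < (omegaGraph P).lab i j ∧ (omegaGraph P).lab i j < P.rank w := by
  obtain ⟨v, hvw, hv⟩ := P.isLRVine.exists_isLUB i.2 j.2 hi hj
  have h1 := omega_lab_eq P hne hv
  have h2 := P.isLRVine.isVine.isRank.mono hvw
  exact ⟨(omega_lab_pos_iff P).2 ⟨hne, v, hv⟩, by omega⟩

variable {P}

theorem le_of_isLUB_pair {x y v w : P.Node} (hv : IsLUB {x, y} v) (hx : x ≤ w) (hy : y ≤ w) :
    v ≤ w := by
  refine hv.2 ?_
  rintro z (rfl | rfl)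
  exacts [hx, hy]

theorem rank_eq_of_isMin {x y : P.Node} (hx : IsMin x) (hy : IsMin y) : P.rank x = P.rank y := by
  rw [P.isLRVine.isVine.isRank.isMin x hx, P.isLRVine.isVine.isRank.isMin y hy]

theorem mem_cond_omega_iff {i j k : (omegaGraph P).Vertex} (hne : i ≠ j) {v : P.Node}
    (hv : IsLUB {i.1, j.1} v) :
    k ∈ (omegaGraph P).cond i j ↔ k.1 ≤ v ∧ k ≠ i ∧ k ≠ j := by
  have hrv := omega_lab_eq P hne hv
  rw [mem_cond]
  constructor
  · rintro ⟨⟨hki, hki'⟩, hkj, hkj'⟩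
    refine ⟨?_, (omegaGraph P).ne_of_lab_pos hki, (omegaGraph P).ne_of_lab_pos hkj⟩
    obtain ⟨p, hp, hrp⟩ := omega_exists_isLUB P hki
    obtain ⟨q, hq, hrq⟩ := omega_exists_isLUB P hkj
    rcases P.isLRVine.helly (rank_eq_of_isMin i.2 j.2) (rank_eq_of_isMin j.2 k.2)
      (hp.1 (.inr rfl)) (hp.1 (.inl rfl)) (hq.1 (.inr rfl)) (hq.1 (.inl rfl))
      (hv.1 (.inl rfl)) (hv.1 (.inr rfl)) with h | h | h
    · have := P.isLRVine.isVine.isRank.mono (le_of_isLUB_pair hv h (hq.1 (.inr rfl)))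
      omega
    · have := P.isLRVine.isVine.isRank.mono (le_of_isLUB_pair hv (hp.1 (.inr rfl)) h)
      omega
    · exact h
  · rintro ⟨hkv, hki, hkj⟩
    obtain ⟨a, b, -, hc, hia, hjb, -, -, hC⟩ := P.isLRVine.exists_faces i.2 j.2
      (fun h => hne (Subtype.ext h)) hv
    obtain ⟨hka, hkb⟩ := IsLRVine.le_faces hc hC k.2 hkv (fun h => hki (Subtype.ext h))
      (fun h => hkj (Subtype.ext h))
    have hra := P.isLRVine.isVine.isRank.covBy _ _ (left_covBy hc)
    have hrb := P.isLRVine.isVine.isRank.covBy _ _ (right_covBy hc)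
    have h1 := omega_lab_lt P hki hka hia
    have h2 := omega_lab_lt P hkj hkb hjb
    omega

theorem clq_omega_eq {i j : (omegaGraph P).Vertex} (hne : i ≠ j) {v : P.Node}
    (hv : IsLUB {i.1, j.1} v) : (omegaGraph P).clq i j = {k | k.1 ≤ v} := by
  ext k
  simp only [clq, Set.mem_insert_iff, mem_cond_omega_iff hne hv, Set.mem_ofPred_eq]
  constructor
  · rintro (rfl | rfl | h)
    exacts [hv.1 (.inl rfl), hv.1 (.inr rfl), h.1]
  · tauto

theorem ncard_le_eq (v : P.Node) : {k : (omegaGraph P).Vertex | k.1 ≤ v}.ncard = P.rank v := by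
  rw [← P.isLRVine.ncard_completeUnion v]
  refine (Set.ncard_image_of_injective _ Subtype.val_injective).symm.trans (congrArg _ ?_)
  ext x
  constructor
  · rintro ⟨k, hk, rfl⟩
    exact ⟨k.2, hk⟩
  · rintro ⟨hx, hxv⟩
    exact ⟨⟨x, hx⟩, hxv, rfl⟩

/-- The elements covered by the join of two adjacent vertices, in terms of the graph. -/
theorem omega_exists_faces {i j : (omegaGraph P).Vertex} (hne : i ≠ j) {v : P.Node}
    (hv : IsLUB {i.1, j.1} v) : ∃ a b, a ≠ b ∧ coveredSet v = {a, b} ∧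
      conditionedSet v = {i.1, j.1} ∧ (∀ k : (omegaGraph P).Vertex, k.1 ≤ a ↔ k = i ∨
        k ∈ (omegaGraph P).cond i j) ∧
      ∀ k : (omegaGraph P).Vertex, k.1 ≤ b ↔ k = j ∨ k ∈ (omegaGraph P).cond i j := by
  obtain ⟨a, b, hab, hc, hia, hjb, hib, hja, hC⟩ := P.isLRVine.exists_faces i.2 j.2
    (fun h => hne (Subtype.ext h)) hv
  refine ⟨a, b, hab, hc, hC, fun k => ?_, fun k => ?_⟩ <;> rw [mem_cond_omega_iff hne hv] <;>
    constructor
  · intro hk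
    by_cases hki : k = i
    · exact .inl hki
    · refine .inr ⟨hk.trans (left_covBy hc).le, hki, ?_⟩
      rintro rfl
      exact hja hk
  · rintro (rfl | ⟨hkv, hki, hkj⟩)
    · exact hia
    · exact (IsLRVine.le_faces hc hC k.2 hkv (fun h => hki (Subtype.ext h))
        (fun h => hkj (Subtype.ext h))).1
  · intro hk
    by_cases hkj : k = j
    · exact .inl hkj
    · refine .inr ⟨hk.trans (right_covBy hc).le, ?_, hkj⟩
      rintro rfl
      exact hib hk
  · rintro (rfl | ⟨hkv, hki, hkj⟩)
    · exact hjb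
    · exact (IsLRVine.le_faces hc hC k.2 hkv (fun h => hki (Subtype.ext h))
        (fun h => hkj (Subtype.ext h))).2

theorem eq_of_forall_le_iff {v w : P.Node}
    (h : ∀ k : (omegaGraph P).Vertex, k.1 ≤ v ↔ k.1 ≤ w) : v = w := by
  refine le_antisymm (P.isLRVine.le_of_completeUnion_subset fun x hx => ?_)
    (P.isLRVine.le_of_completeUnion_subset fun x hx => ?_)
  · exact ⟨hx.1, (h ⟨x, hx.1⟩).1 hx.2⟩
  · exact ⟨hx.1, (h ⟨x, hx.1⟩).2 hx.2⟩

theorem isWeakMAT_omega (P : LRV.{u}) : (omegaGraph P).IsWeakMAT where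
  triangles i j hij := by
    obtain ⟨hne, v, hv⟩ := (omega_lab_pos_iff P).1 hij
    have h1 := omega_lab_eq P hne hv
    have h2 : ((omegaGraph P).clq i j).ncard = P.rank v := by
      rw [clq_omega_eq hne hv, ncard_le_eq]
    rw [clq, Set.ncard_insert_of_notMem, Set.ncard_insert_of_notMem
      ((omegaGraph P).right_notMem_cond i j)] at h2
    · omega
    · rintro (h | h)
      exacts [hne h, (omegaGraph P).left_notMem_cond i j h]
  -- by the Helly property, a clique lies below the join of an edge of largest label
  clique k hk C hC := by
    by_cases hsub : C.Subsingleton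
    · exact (Set.ncard_le_one_iff_subsingleton.2 hsub).trans hk
    rw [Set.not_subsingleton_iff] at hsub
    obtain ⟨x, hx, y, hy, hxy⟩ := hsub
    obtain ⟨⟨i, j⟩, ⟨hi, hj, hij⟩, hmax⟩ := Set.exists_max_image
      {e : (omegaGraph P).Vertex × (omegaGraph P).Vertex | e.1 ∈ C ∧ e.2 ∈ C ∧ e.1 ≠ e.2}
      (fun e => (omegaGraph P).lab e.1 e.2) (Set.toFinite _) ⟨(x, y), hx, hy, hxy⟩
    have hi : i ∈ C := hi
    have hj : j ∈ C := hj
    have hij : i ≠ j := hij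
    have hlab := hC hi hj hij
    rw [below_adj] at hlab
    obtain ⟨v, hv, hrv⟩ := omega_exists_isLUB P hlab.1
    have hsub : C ⊆ {k | k.1 ≤ v} := by
      intro k hkC
      by_cases hki : k = i
      · exact hki ▸ hv.1 (.inl rfl)
      by_cases hkj : k = j
      · exact hkj ▸ hv.1 (.inr rfl)
      obtain ⟨p, hp, hrp⟩ := omega_exists_isLUB P (hC hkC hi hki).1
      obtain ⟨q, hq, hrq⟩ := omega_exists_isLUB P (hC hkC hj hkj).1
      have hmp : (omegaGraph P).lab k i ≤ (omegaGraph P).lab i j := hmax (k, i) ⟨hkC, hi, hki⟩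
      have hmq : (omegaGraph P).lab k j ≤ (omegaGraph P).lab i j := hmax (k, j) ⟨hkC, hj, hkj⟩
      rcases P.isLRVine.helly (rank_eq_of_isMin i.2 j.2) (rank_eq_of_isMin j.2 k.2)
        (hp.1 (.inr rfl)) (hp.1 (.inl rfl)) (hq.1 (.inr rfl)) (hq.1 (.inl rfl))
        (hv.1 (.inl rfl)) (hv.1 (.inr rfl)) with h | h | h
      · have hvq := P.isLRVine.isVine.isRank.eq_of_le
          (le_of_isLUB_pair hv h (hq.1 (.inr rfl))) (by omega)
        exact hvq ▸ hq.1 (.inl rfl)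
      · have hvp := P.isLRVine.isVine.isRank.eq_of_le
          (le_of_isLUB_pair hv (hp.1 (.inr rfl)) h) (by omega)
        exact hvp ▸ hp.1 (.inl rfl)
      · exact h
    have := Set.ncard_le_ncard hsub (Set.toFinite _)
    rw [ncard_le_eq] at this
    omega
  -- a chain of edges with the conditioning vertices of `ab` is a walk in an associated forest
  sparse a b hab hchain := by
    have hne := (omegaGraph P).ne_of_lab_pos hab
    obtain ⟨v, hv, hrv⟩ := omega_exists_isLUB P hab
    obtain ⟨A, B, -, hc, hC, hA, hB⟩ := omega_exists_faces hne hv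
    have hrA := P.isLRVine.isVine.isRank.covBy _ _ (left_covBy hc)
    have hrB := P.isLRVine.isVine.isRank.covBy _ _ (right_covBy hc)
    have hrA : P.rank A = (omegaGraph P).lab a b := by omega
    have hrB : P.rank B = (omegaGraph P).lab a b := by omega
    have key : ∀ y : (omegaGraph P).Vertex,
        ReflTransGen (fun x y => (omegaGraph P).lab x y = (omegaGraph P).lab a b ∧
          s(x, y) ≠ s(a, b) ∧ (omegaGraph P).cond x y = (omegaGraph P).cond a b) a y →
        ∃ (Y : P.Node) (hY : P.rank Y = (omegaGraph P).lab a b),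
          (∀ k : (omegaGraph P).Vertex, k.1 ≤ Y ↔ k = y ∨ k ∈ (omegaGraph P).cond a b) ∧
          ((associatedForest P.rank ((omegaGraph P).lab a b)).deleteEdges
            {s(⟨A, hrA⟩, ⟨B, hrB⟩)}).Reachable ⟨A, hrA⟩ ⟨Y, hY⟩ := by
      intro y hy
      induction hy with
      | refl => exact ⟨A, hrA, hA, .refl _⟩
      | @tail x y _ hxy ih =>
        obtain ⟨X, hrX, hX, hreach⟩ := ih
        obtain ⟨hlab, hsne, hcond⟩ := hxy
        have hxypos : 0 < (omegaGraph P).lab x y := hlab ▸ hab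
        obtain ⟨w, hw, hrw⟩ := omega_exists_isLUB P hxypos
        obtain ⟨X', Y, hXY, hcw, hCw, hX', hY⟩ :=
          omega_exists_faces ((omegaGraph P).ne_of_lab_pos hxypos) hw
        rw [hcond] at hX' hY
        obtain rfl : X = X' := eq_of_forall_le_iff fun k => (hX k).trans (hX' k).symm
        have hrY := P.isLRVine.isVine.isRank.covBy _ _ (right_covBy hcw)
        refine ⟨Y, by omega, hY, hreach.trans (SimpleGraph.Adj.reachable ?_)⟩
        rw [SimpleGraph.deleteEdges_adj]
        refine ⟨⟨fun h => hXY (Subtype.mk.inj h), w, by omega, hcw⟩, fun hmem => hsne ?_⟩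
        have hwv : w = v := by
          rw [Set.mem_singleton_iff, Sym2.eq_iff] at hmem
          have hcc : coveredSet w = {A, B} := by
            rw [hcw]
            rcases hmem with ⟨h1, h2⟩ | ⟨h1, h2⟩
            · rw [Subtype.mk.inj h1, Subtype.mk.inj h2]
            · rw [Subtype.mk.inj h1, Subtype.mk.inj h2, Set.pair_comm]
          have hAB : A ≠ B := by
            rintro rfl
            rw [hcw] at hcc
            have h1 : X ∈ ({A, A} : Set P.Node) := hcc ▸ .inl rfl
            have h2 : Y ∈ ({A, A} : Set P.Node) := hcc ▸ .inr rfl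
            rw [Set.pair_eq_singleton] at h1 h2
            exact hXY (h1.trans h2.symm)
          exact P.isLRVine.isVine.covered_unique A B hAB (hrA.trans hrB.symm) w v
            (left_covBy hcc) (right_covBy hcc) (left_covBy hc) (right_covBy hc)
        rw [hwv, hC] at hCw
        rw [Sym2.eq_iff]
        rcases Set.pair_eq_pair_iff.1 hCw with ⟨h1, h2⟩ | ⟨h1, h2⟩
        · exact .inl ⟨Subtype.ext h1.symm, Subtype.ext h2.symm⟩
        · exact .inr ⟨Subtype.ext h2.symm, Subtype.ext h1.symm⟩
    obtain ⟨Y, hrY, hY, hreach⟩ := key b hchain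
    obtain rfl : Y = B := eq_of_forall_le_iff fun k => (hY k).trans (hB k).symm
    have hacyc := P.isLRVine.isVine.isAcyclic (i := (omegaGraph P).lab a b) hab
    rw [SimpleGraph.isAcyclic_iff_forall_adj_isBridge] at hacyc
    refine SimpleGraph.isBridge_iff.1 (hacyc (v := ⟨A, hrA⟩) (w := ⟨Y, hrB⟩) ?_) hreach
    refine ⟨fun h => ?_, v, hrv.symm, hc⟩
    have hAY : A = Y := Subtype.mk.inj h
    have haY := (hY a).1 (hAY ▸ (hA a).2 (.inl rfl))
    rcases haY with h | h
    exacts [hne h, (omegaGraph P).left_notMem_cond a b h]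

theorem exists_omega_map {P' : LRV.{u}} (φ : RankedPoset.Hom P.toRankedPoset P'.toRankedPoset) :
    ∃ σ : EdgeLabeledGraph.Hom (omegaGraph P) (omegaGraph P'),
      ∀ i, (σ.toFun i).1 = φ.toFun i.1 := by
  have hmin : ∀ x : P.Node, IsMin x → IsMin (φ.toFun x) := by
    intro x hx
    rw [P'.isLRVine.isVine.isRank.isMin_iff, φ.map_rank, P.isLRVine.isVine.isRank.isMin x hx]
  refine ⟨⟨fun i => ⟨φ.toFun i.1, hmin i.1 i.2⟩, fun i j hij => ?_⟩, fun i => rfl⟩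
  have hpos := (omegaGraph P).lab_pos_iff.2 hij
  obtain ⟨v, hv, hr⟩ := omega_exists_isLUB P hpos
  have hv' := φ.map_join _ _ _ hv
  have hne : (⟨φ.toFun i.1, hmin i.1 i.2⟩ : (omegaGraph P').Vertex) ≠
      ⟨φ.toFun j.1, hmin j.1 j.2⟩ := by
    intro heq
    have heq : φ.toFun i.1 = φ.toFun j.1 := Subtype.mk.inj heq
    rw [heq, Set.pair_eq_singleton] at hv'
    have h1 := φ.map_rank v
    rw [hv'.unique isLUB_singleton, φ.map_rank, P.isLRVine.isVine.isRank.isMin j.1 j.2] at h1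
    omega
  have hr' := omega_lab_eq P' hne hv'
  rw [φ.map_rank] at hr'
  refine ⟨⟨hne, _, hv'⟩, PNat.coe_inj.1 ?_⟩
  refine ((omegaGraph P').lab_eq _).trans (Eq.trans ?_ ((omegaGraph P).lab_eq hij).symm)
  omega

theorem adj_omega_eq_conditionedSet (P : LRV.{u}) :
    {s : Set P.Node | ∃ i j, (omegaGraph P).graph.Adj i j ∧ s = {i.1, j.1}} =
      {s : Set P.Node | ∃ v, ¬ IsMin v ∧ s = conditionedSet v} := by
  ext s
  constructor
  · rintro ⟨i, j, ⟨hne, v, hv⟩, rfl⟩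
    have hne' : i.1 ≠ j.1 := fun h => hne (Subtype.ext h)
    obtain ⟨a, b, -, -, -, -, -, -, hC⟩ := P.isLRVine.exists_faces i.2 j.2 hne' hv
    exact ⟨v, IsLRVine.not_isMin_of_isLUB hne' hv, hC.symm⟩
  · rintro ⟨v, hv, rfl⟩
    obtain ⟨i, j, hi, hj, hne, hlub, hC⟩ := P.isLRVine.exists_isLUB_eq hv
    exact ⟨⟨i, hi⟩, ⟨j, hj⟩, ⟨fun h => hne (Subtype.mk.inj h), v, hlub⟩, hC⟩

end LRV

/-! ### The equivalence of categories -/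

open EdgeLabeledGraph

/-- An order isomorphism which preserves the rank is an isomorphism of LR-vines. -/
def LRV.isoOfOrderIso {P Q : LRV.{u}} (e : P.Node ≃o Q.Node)
    (he : ∀ x, Q.rank (e x) = P.rank x) : P ≅ Q where
  hom := RankedPoset.Hom.mk e e.monotone he fun x y v h => by
    rw [← Set.image_pair]
    exact e.isLUB_image'.2 h
  inv := RankedPoset.Hom.mk e.symm e.symm.monotone
    (fun x => by rw [← he, e.apply_symm_apply]) fun x y v h => by
    rw [← Set.image_pair]
    exact e.symm.isLUB_image'.2 h
  hom_inv_id := RankedPoset.Hom.ext (funext fun x => e.symm_apply_apply x)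
  inv_hom_id := RankedPoset.Hom.ext (funext fun x => e.apply_symm_apply x)

/-- A bijection of the vertices which preserves adjacency and labels is an isomorphism of
MAT-labeled graphs. -/
def MG.isoOfEquiv {G H : MG.{u}} (e : G.Vertex ≃ H.Vertex)
    (he : ∀ x y, H.lab (e x) (e y) = G.lab x y) : G ≅ H where
  hom := EdgeLabeledGraph.Hom.mk e fun x y h => by
    have hpos := G.lab_pos_iff.2 h
    rw [← he] at hpos
    refine ⟨H.lab_pos_iff.1 hpos, PNat.coe_inj.1 ?_⟩
    rw [H.lab_eq, G.lab_eq, he]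
  inv := EdgeLabeledGraph.Hom.mk e.symm fun x y h => by
    have hpos := H.lab_pos_iff.2 h
    have heq := he (e.symm x) (e.symm y)
    rw [e.apply_symm_apply, e.apply_symm_apply] at heq
    rw [heq] at hpos
    refine ⟨G.lab_pos_iff.1 hpos, PNat.coe_inj.1 ?_⟩
    rw [H.lab_eq, G.lab_eq, heq]
  hom_inv_id := EdgeLabeledGraph.Hom.ext (funext fun x => e.symm_apply_apply x)
  inv_hom_id := EdgeLabeledGraph.Hom.ext (funext fun x => e.apply_symm_apply x)

namespace LRV

variable (P : LRV.{u})

/-- The minimal elements below `v` form a singleton or a principal clique of the graph of `P`. -/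
theorem isNode_below (v : P.Node) :
    (∃ i, {k : (omegaGraph P).Vertex | k.1 ≤ v} = {i}) ∨
      ∃ e, {k : (omegaGraph P).Vertex | k.1 ≤ v} = (omegaGraph P).principalClique e := by
  by_cases hv : IsMin v
  · refine .inl ⟨⟨v, hv⟩, ?_⟩
    ext k
    constructor
    · exact fun hk => Subtype.ext (hk.antisymm (hv hk))
    · rintro rfl
      exact le_rfl (a := v)
  · obtain ⟨i, j, hi, hj, hne, hlub, -⟩ := P.isLRVine.exists_isLUB_eq hv
    have hne' : (⟨i, hi⟩ : (omegaGraph P).Vertex) ≠ ⟨j, hj⟩ := fun h => hne (Subtype.mk.inj h)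
    refine .inr ⟨⟨s(⟨i, hi⟩, ⟨j, hj⟩), hne', v, hlub⟩, ?_⟩
    exact (clq_omega_eq hne' hlub).symm.trans ((omegaGraph P).principalClique_eq _).symm

/-- The map sending an element of an LR-vine to the set of minimal elements below it, viewed as
an element of the poset of principal cliques, is an order isomorphism. -/
noncomputable def unitOrderIso : P.Node ≃o (psiPoset (omegaGraph P)).Node := by
  let f : P.Node → (psiPoset (omegaGraph P)).Node := fun v => ⟨_, isNode_below P v⟩
  have hle : ∀ v w, f v ≤ f w ↔ v ≤ w := by
    intro v w
    constructor
    · intro h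
      exact P.isLRVine.le_of_completeUnion_subset fun x hx =>
        ⟨hx.1, h (show (⟨x, hx.1⟩ : (omegaGraph P).Vertex) ∈ (f v).1 from hx.2)⟩
    · exact fun h k hk => le_trans (show k.1 ≤ v from hk) h
  have hinj : Function.Injective f := fun v w h =>
    ((hle v w).1 h.le).antisymm ((hle w v).1 h.ge)
  have hsurj : Function.Surjective f := by
    intro C
    rcases IsWeakMAT.singleton_or_exists_clq C with ⟨i, hi⟩ | ⟨i, j, hij, hC⟩
    · refine ⟨i.1, Subtype.ext ?_⟩
      rw [hi]
      ext k
      constructor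
      · exact fun hk => Subtype.ext (le_antisymm hk (i.2 hk))
      · rintro rfl
        exact le_rfl (a := k.1)
    · obtain ⟨hne, v, hv⟩ := (omega_lab_pos_iff P).1 hij
      exact ⟨v, Subtype.ext ((clq_omega_eq hne hv).symm.trans hC.symm)⟩
  exact { Equiv.ofBijective f ⟨hinj, hsurj⟩ with map_rel_iff' := fun {v w} => hle v w }

theorem rank_unitOrderIso (v : P.Node) :
    (psiPoset (omegaGraph P)).rank (unitOrderIso P v) = P.rank v :=
  ncard_le_eq v

variable {P}

theorem unitOrderIso_natural {P' : LRV.{u}}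
    (φ : RankedPoset.Hom P.toRankedPoset P'.toRankedPoset)
    (σ : EdgeLabeledGraph.Hom (omegaGraph P) (omegaGraph P'))
    (hσ : ∀ i, (σ.toFun i).1 = φ.toFun i.1) (v : P.Node) :
    σ.toFun '' (unitOrderIso P v).1 = (unitOrderIso P' (φ.toFun v)).1 := by
  refine Set.eq_of_subset_of_ncard_le ?_ ?_ (Set.toFinite _)
  · rintro _ ⟨k, hk, rfl⟩
    change (σ.toFun k).1 ≤ φ.toFun v
    rw [hσ]
    exact φ.monotone hk
  · rw [IsWeakMAT.ncard_image_isNode σ ((isWeakMAT_omega P).isNode_val _)]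
    refine (rank_unitOrderIso P' _).trans_le ((φ.map_rank v).trans_le ?_)
    exact (rank_unitOrderIso P v).ge

end LRV

namespace MG

variable (G : MG.{u})

/-- The vertices of an MAT-labeled graph are the minimal elements of its poset of principal
cliques. -/
noncomputable def singletonEquiv :
    G.Vertex ≃ {v : (psiPoset G.toEdgeLabeledGraph).Node // IsMin v} :=
  Equiv.ofBijective
    (fun i => ⟨⟨{i}, .inl ⟨i, rfl⟩⟩, G.isMAT.isWeakMAT.isMin_psi_iff.2 ⟨i, rfl⟩⟩)
    ⟨fun i j h => Set.singleton_injective (congrArg (fun v => v.1.1) h), fun v => by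
      obtain ⟨i, hi⟩ := G.isMAT.isWeakMAT.isMin_psi_iff.1 v.2
      exact ⟨i, Subtype.ext (Subtype.ext hi.symm)⟩⟩

theorem singletonEquiv_val (i : G.Vertex) : (singletonEquiv G i).1.1 = {i} := rfl

theorem lab_singletonEquiv (h : IsLRVine (psiPoset G.toEdgeLabeledGraph).rank) (i j : G.Vertex) :
    (omegaGraph ⟨psiPoset G.toEdgeLabeledGraph, h⟩).lab (singletonEquiv G i)
      (singletonEquiv G j) = G.lab i j := by
  have hG := G.isMAT.isWeakMAT
  rcases Nat.eq_zero_or_pos (G.lab i j) with h0 | hpos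
  · rw [h0]
    by_contra hne0
    obtain ⟨hne, v, hv⟩ := (LRV.omega_lab_pos_iff _).1 (Nat.pos_of_ne_zero hne0)
    have hi : i ∈ v.1 := hv.1 (.inl rfl) (by rw [singletonEquiv_val]; rfl)
    have hj : j ∈ v.1 := hv.1 (.inr rfl) (by rw [singletonEquiv_val]; rfl)
    exact ((hG.isNode_val v).2 hi hj (fun h => hne (by rw [h]))).1.ne' h0
  · obtain ⟨v, hv⟩ := hG.exists_node (hG.isNode_clq hpos)
    have hlub := (hG.isLUB_psi hpos (singletonEquiv_val G i) (singletonEquiv_val G j)).2 hv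
    have := LRV.omega_lab_eq ⟨psiPoset G.toEdgeLabeledGraph, h⟩
      (fun h => G.ne_of_lab_pos hpos ((singletonEquiv G).injective h)) hlub
    change _ = v.1.ncard at this
    rw [hv, hG.ncard_clq hpos] at this
    omega

end MG

theorem mainTheorem1 :
    ∃ (hΨobj : ∀ G : MG.{u}, IsLRVine (psiPoset G.toEdgeLabeledGraph).rank)
      (hΨmap : ∀ (G G' : MG.{u}) (σ : G ⟶ G'),
        ∃ φ : RankedPoset.Hom (psiPoset G.toEdgeLabeledGraph) (psiPoset G'.toEdgeLabeledGraph),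
          ∀ v, (φ.toFun v).1 = EdgeLabeledGraph.Hom.toFun σ '' v.1)
      (hΩobj : ∀ P : LRV.{u}, (omegaGraph P).IsMAT)
      (hΩmap : ∀ (P P' : LRV.{u}) (φ : P ⟶ P'),
        ∃ σ : EdgeLabeledGraph.Hom (omegaGraph P) (omegaGraph P'),
          ∀ i, (σ.toFun i).1 = RankedPoset.Hom.toFun φ i.1),
      -- the edges of `Ω(P)` are exactly the conditioned sets of the non-minimal nodes of `P`
      (∀ P : LRV.{u},
        {s : Set P.Node | ∃ i j, (omegaGraph P).graph.Adj i j ∧ s = {i.1, j.1}} =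
          {s : Set P.Node | ∃ v, ¬ IsMin v ∧ s = conditionedSet v}) ∧
      Nonempty (omegaFunctor hΩobj hΩmap ⋙ psiFunctor hΨobj hΨmap ≅ 𝟭 LRV.{u}) ∧
      Nonempty (psiFunctor hΨobj hΨmap ⋙ omegaFunctor hΩobj hΩmap ≅ 𝟭 MG.{u}) ∧
      ∃ E : MG.{u} ≌ LRV.{u},
        E.functor = psiFunctor hΨobj hΨmap ∧ E.inverse = omegaFunctor hΩobj hΩmap := by
  have hΨobj : ∀ G : MG.{u}, IsLRVine (psiPoset G.toEdgeLabeledGraph).rank := fun G =>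
    G.isMAT.isWeakMAT.isLRVine_psi
  have hΨmap : ∀ (G G' : MG.{u}) (σ : G ⟶ G'),
      ∃ φ : RankedPoset.Hom (psiPoset G.toEdgeLabeledGraph) (psiPoset G'.toEdgeLabeledGraph),
        ∀ v, (φ.toFun v).1 = EdgeLabeledGraph.Hom.toFun σ '' v.1 := fun G G' σ =>
    G.isMAT.isWeakMAT.exists_psi_map G'.isMAT.isWeakMAT σ
  have hΩobj : ∀ P : LRV.{u}, (omegaGraph P).IsMAT := fun P => (LRV.isWeakMAT_omega P).isMAT
  have hΩmap : ∀ (P P' : LRV.{u}) (φ : P ⟶ P'),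
      ∃ σ : EdgeLabeledGraph.Hom (omegaGraph P) (omegaGraph P'),
        ∀ i, (σ.toFun i).1 = RankedPoset.Hom.toFun φ i.1 := fun P P' φ => LRV.exists_omega_map φ
  have ε : 𝟭 LRV.{u} ≅ omegaFunctor hΩobj hΩmap ⋙ psiFunctor hΨobj hΨmap := by
    refine NatIso.ofComponents (fun P => LRV.isoOfOrderIso (LRV.unitOrderIso P)
      (LRV.rank_unitOrderIso P)) fun {P P'} φ => ?_
    refine RankedPoset.Hom.ext (funext fun v => Subtype.ext ?_)
    exact ((((hΨmap _ _ _).choose_spec _).trans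
      (LRV.unitOrderIso_natural φ _ (hΩmap P P' φ).choose_spec v))).symm
  have η : 𝟭 MG.{u} ≅ psiFunctor hΨobj hΨmap ⋙ omegaFunctor hΩobj hΩmap := by
    refine NatIso.ofComponents (fun G => MG.isoOfEquiv (MG.singletonEquiv G)
      (MG.lab_singletonEquiv G (hΨobj G))) fun {G G'} σ => ?_
    refine EdgeLabeledGraph.Hom.ext (funext fun i => Subtype.ext (Subtype.ext ?_))
    refine Eq.symm ((congrArg Subtype.val ((hΩmap _ _ _).choose_spec _)).trans ?_)
    exact ((hΨmap G G' σ).choose_spec _).trans (Set.image_singleton)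
  exact ⟨hΨobj, hΨmap, hΩobj, hΩmap, LRV.adj_omega_eq_conditionedSet, ⟨ε.symm⟩, ⟨η.symm⟩,
    CategoryTheory.Equivalence.mk _ _ η ε.symm, rfl, rfl⟩
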